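/- **Conventions.** Fix a universe; "small" refers to it, and all categories have small hom-sets. *Tangent categories.* A tangent structure $\mathbb T=(T,p,0,+,\ell,c)$ on a category $\mathcal C$ (Rosický, Cockett–Cruttwell) consists of a functor $T:\mathcal C\to\mathcal C$ and natural transformations $p:T\Rightarrow\mathrm{id}$, $0:\mathrm{id}\Rightarrow T$, $+:T_2\Rightarrow T$, $\ell:T\Rightarrow T^2$, $c:T^2\Rightarrow T^2$ such that: 1. for all $X$ and $n\in\mathbb N$ the $n$-fold pullback power of $p_X:TX\to X$ exists and is preserved by every $T^m$ ($m\in\mathbb N$); $T_2X=TX\times_XTX$ with projections $\pi_1,\pi_2$; 2. $0_X$ and $+_X$ make $p_X$ a commutative monoid in $\mathcal C_{/X}$; 3. $T(p)\circ\ell=0\circ p$, $\ \ell\circ 0=0_T\circ 0$, $\ \ell\circ{+}={+_T}\circ\langle\ell\pi_1,\ell\pi_2\rangle$; 4. $p_T\circ c=T(p)$, $\ c\circ T(0)=0_T$, $\ c\circ T(+)={+_T}\circ\langle c\,T(\pi_1),c\,T(\pi_2)\rangle$; 5. $c^2=\mathrm{id}$, $\ c\circ\ell=\ell$, $\ T(\ell)\circ\ell=\ell_T\circ\ell$,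 $\ T(c)\circ c_T\circ T(c)=c_T\circ T(c)\circ c_T$, $\ c_T\circ T(c)\circ\ell_T=T(\ell)\circ c$; 6. $T(+_X)\circ\langle\ell\pi_1,0_T\pi_2\rangle:T_2X\to T^2X$ is an equalizer of $T(p_X)$ and $0_X\circ p_X\circ p_{TX}$ for every $X$. A tangent morphism $(F,\alpha):(\mathcal C,\mathbb T)\to(\mathcal D,\mathbb S)$, where $\mathbb S=(S,q,0',\oplus,\ell',c')$, is a functor $F:\mathcal C\to\mathcal D$ with a natural transformation $\alpha:F\circ T\Rightarrow S\circ F$ such that $q_F\circ\alpha=F(p)$, $\ \alpha\circ F(0)=0'_F$, $\ \alpha\circ F(+)=\oplus_F\circ\langle\alpha F(\pi_1),\alpha F(\pi_2)\rangle$, $\ \ell'_F\circ\alpha=S(\alpha)\circ\alpha_T\circ F(\ell)$ and $c'_F\circ S(\alpha)\circ\alpha_T=S(\alpha)\circ\alpha_T\circ F(c)$. It is strong if $\alpha$ is invertible and $F$ preserves the pullback powers in 1 and the equalizers in 6. A tangent transformation $(F,\alpha)\Rightarrow(G,\beta)$ is a natural transformation $\rho:F\Rightarrow G$ with $S(\rho)\circ\alpha=\beta\circ\rho_T$.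 Tangent categories, tangent morphisms with composition $(G,\beta)\circ(F,\alpha)=(GF,\beta_F\circ G(\alpha))$, and tangent transformations form a 2-category $\mathfrak{Tan}$, with a forgetful 2-functor to $\mathfrak{Cat}$. *Ind-categories.* The objects of $\mathrm{Ind}(\mathcal C)$ are the functors $\underline X=(X_i)_{i\in I}:I\to\mathcal C$ with $I$ small and filtered, and $\mathrm{Ind}(\mathcal C)(\underline X,\underline Y)=\lim_i\operatorname{colim}_j\mathcal C(X_i,Y_j)$. Put $\mathrm{Ind}(F)(X_i)=(FX_i)$ for a functor $F$ and $\mathrm{Ind}(\alpha)_{\underline X}=(\alpha_{X_i})$ for a natural transformation $\alpha$, and let $\phi_{F,G}:\mathrm{Ind}(G)\circ\mathrm{Ind}(F)\cong\mathrm{Ind}(G\circ F)$ be the canonical (levelwise identity) isomorphisms. These make $\mathrm{Ind}$ a pseudofunctor $\mathfrak{Cat}\to\mathfrak{Cat}$, with $\mathrm{Ind}(\mathrm{id}_{\mathcal C})=\mathrm{id}$. For a tangent structure $\mathbb T$ on $\mathcal C$ put $$\mathrm{Ind}(\mathbb T)=\bigl(\mathrm{Ind}(T),\ \mathrm{Ind}(p),\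 \mathrm{Ind}(0),\ \mathrm{Ind}(+),\ \phi_{T,T}^{-1}\circ\mathrm{Ind}(\ell),\ \phi_{T,T}^{-1}\circ\mathrm{Ind}(c)\circ\phi_{T,T}\bigr),$$ where $\mathrm{Ind}(T_2)$, with the projections $\mathrm{Ind}(\pi_1)$ and $\mathrm{Ind}(\pi_2)$, is taken as $\mathrm{Ind}(T)_2$. **Theorem.** (a) Let $(F,\alpha):(\mathcal C,\mathbb T)\to(\mathcal D,\mathbb S)$ be a tangent morphism and let $$\hat\alpha=\phi_{F,S}^{-1}\circ\mathrm{Ind}(\alpha)\circ\phi_{T,F}:\ \mathrm{Ind}(F)\circ\mathrm{Ind}(T)\Rightarrow\mathrm{Ind}(S)\circ\mathrm{Ind}(F).$$ Then $(\mathrm{Ind}(\mathcal C),\mathrm{Ind}(\mathbb T))$ and $(\mathrm{Ind}(\mathcal D),\mathrm{Ind}(\mathbb S))$ are tangent categories, and $(\mathrm{Ind}(F),\hat\alpha)$ is a tangent morphism between them. Moreover, $(\mathrm{Ind}(F),\hat\alpha)$ is strong if and only if $(F,\alpha)$ is strong. (b) The assignments $(\mathcal C,\mathbb T)\mapsto(\mathrm{Ind}(\mathcal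 C),\mathrm{Ind}(\mathbb T))$, $(F,\alpha)\mapsto(\mathrm{Ind}(F),\hat\alpha)$, $\rho\mapsto\mathrm{Ind}(\rho)$ are well defined and underlie a pseudofunctor $\mathrm{Ind}:\mathfrak{Tan}\to\mathfrak{Tan}$, whose composite with the forgetful 2-functor $\mathfrak{Tan}\to\mathfrak{Cat}$ is equal, as a pseudofunctor, to the composite of the forgetful 2-functor with $\mathrm{Ind}:\mathfrak{Cat}\to\mathfrak{Cat}$. -/

import Mathlib

open CategoryTheory CategoryTheory.Limits Opposite

universe v u u₁ u₂ u₃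

/- With this instance, `X ⟶ Y` would be read through reflexive quivers. -/
attribute [-instance] CategoryTheory.catToReflQuiver

namespace IndTan

/-! ### The ind-category of a category -/

/-- An ind-object of `C`: a functor `F : I ⥤ C` on a (small) filtered category `I`. -/
structure IndObj (C : Type u) [Category.{v} C] where
  /-- the indexing category -/
  I : Type v
  [category : SmallCategory I]
  [isFiltered : IsFiltered I]
  /-- the filtered system -/
  F : I ⥤ C

attribute [instance] IndObj.category IndObj.isFiltered

section Ind

variable {C : Type u₁} [Category.{v} C] {D : Type u₂} [Category.{v} D]
  {E : Type u₃} [Category.{v} E]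

namespace IndObj

/-- The filtered colimit of sets `colim_j C(A, Y_j)`. -/
def Germ (Y : IndObj C) (A : C) : Type v :=
  (Y.F ⋙ coyoneda.obj (op A)).ColimitType

/-- The class in `colim_j C(A, Y_j)` of a morphism `A ⟶ Y_j`. -/
def germ (Y : IndObj C) {A : C} (j : Y.I) (φ : A ⟶ Y.F.obj j) : Y.Germ A :=
  (Y.F ⋙ coyoneda.obj (op A)).ιColimitType j φ

theorem germ_map (Y : IndObj C) {A : C} {j j' : Y.I} (g : j ⟶ j') (φ : A ⟶ Y.F.obj j) :
    Y.germ j' (φ ≫ Y.F.map g) = Y.germ j φ :=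
  (Y.F ⋙ coyoneda.obj (op A)).ιColimitType_map g φ

theorem exists_germ (Y : IndObj C) {A : C} (x : Y.Germ A) :
    ∃ (j : Y.I) (φ : A ⟶ Y.F.obj j), Y.germ j φ = x :=
  (Y.F ⋙ coyoneda.obj (op A)).ιColimitType_jointly_surjective x

/-- The universal property of the colimit `colim_j C(A, Y_j)`. -/
def Germ.desc {Y : IndObj C} {A : C} {S : Type v} (h : ∀ j, (A ⟶ Y.F.obj j) → S)
    (hh : ∀ {j j'} (g : j ⟶ j') (φ : A ⟶ Y.F.obj j), h j' (φ ≫ Y.F.map g) = h j φ) :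
    Y.Germ A → S :=
  (Y.F ⋙ coyoneda.obj (op A)).descColimitType
    { pt := S
      ι := fun j φ => h j φ
      ι_naturality := fun g => funext fun φ => hh g φ }

/-- Precomposition `colim_j C(A, Y_j) → colim_j C(A', Y_j)` with `a : A' ⟶ A`. -/
def Germ.precomp {Y : IndObj C} {A A' : C} (a : A' ⟶ A) : Y.Germ A → Y.Germ A' :=
  Germ.desc (fun j φ => Y.germ j (a ≫ φ)) (fun g φ => by
    rw [← Category.assoc, germ_map])

theorem Germ.precomp_id {Y : IndObj C} {A : C} (x : Y.Germ A) : Germ.precomp (𝟙 A) x = x := by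
  obtain ⟨j, φ, rfl⟩ := Y.exists_germ x
  exact congrArg (Y.germ j) (Category.id_comp φ)

theorem Germ.precomp_precomp {Y : IndObj C} {A A' A'' : C} (a : A' ⟶ A) (b : A'' ⟶ A')
    (x : Y.Germ A) : Germ.precomp b (Germ.precomp a x) = Germ.precomp (b ≫ a) x := by
  obtain ⟨j, φ, rfl⟩ := Y.exists_germ x
  exact congrArg (Y.germ j) (Category.assoc b a φ).symm

/-- A morphism of ind-objects: an element of `lim_i colim_j C(X_i, Y_j)`. -/
@[ext]
structure Hom (X Y : IndObj C) where
  /-- the component in `colim_j C(X_i, Y_j)` -/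
  val : ∀ i : X.I, Y.Germ (X.F.obj i)
  compat : ∀ {i i' : X.I} (f : i ⟶ i'), Germ.precomp (X.F.map f) (val i') = val i

/-- The action `colim_j C(A, Y_j) → colim_k C(A, Z_k)` of a morphism of ind-objects, which sends
the class of `φ : A ⟶ Y_j` to the class of `g_j ∘ φ`. -/
def Hom.act {Y Z : IndObj C} (g : Hom Y Z) {A : C} : Y.Germ A → Z.Germ A :=
  Germ.desc (fun j φ => Germ.precomp φ (g.val j)) (fun f φ => by
    rw [← Germ.precomp_precomp, g.compat])

theorem Hom.act_precomp {Y Z : IndObj C} (g : Hom Y Z) {A A' : C} (a : A' ⟶ A) (x : Y.Germ A) :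
    g.act (Germ.precomp a x) = Germ.precomp a (g.act x) := by
  obtain ⟨j, φ, rfl⟩ := Y.exists_germ x
  exact (Germ.precomp_precomp φ a (g.val j)).symm

instance : Category.{v} (IndObj C) where
  Hom X Y := Hom X Y
  id X :=
    { val := fun i => X.germ i (𝟙 _)
      compat := fun {i i'} f => by
        refine Eq.trans ?_ (X.germ_map f (𝟙 _))
        exact congrArg (X.germ i') (by simp) }
  comp f g :=
    { val := fun i => g.act (f.val i)
      compat := fun h => by rw [← Hom.act_precomp, f.compat] }
  id_comp {X Y} f := Hom.ext (funext fun i => Germ.precomp_id (f.val i))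
  comp_id {X Y} f := Hom.ext (funext fun i => by
    obtain ⟨j, φ, h⟩ := Y.exists_germ (f.val i)
    change Hom.act _ (f.val i) = f.val i
    rw [← h]
    exact congrArg (Y.germ j) (Category.comp_id φ))
  assoc {W X Y Z} f g h := Hom.ext (funext fun i => by
    obtain ⟨j, φ, hφ⟩ := X.exists_germ (f.val i)
    change h.act (g.act (f.val i)) = Hom.act _ (f.val i)
    rw [← hφ]
    exact h.act_precomp φ (g.val j))

/-- The morphism of ind-objects with the same indexing category that is given by a natural
transformation. -/
def homOfNatTrans {I : Type v} [SmallCategory I] [IsFiltered I] {X Y : I ⥤ C} (η : X ⟶ Y) :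
    (⟨I, X⟩ : IndObj C) ⟶ ⟨I, Y⟩ :=
  { val := fun i => germ ⟨I, Y⟩ i (η.app i)
    compat := fun {i i'} f => by
      refine Eq.trans ?_ (germ_map ⟨I, Y⟩ f (η.app i))
      exact congrArg (germ ⟨I, Y⟩ i') (η.naturality f) }

/-- The action of a functor on germs: the class of `φ : A ⟶ Y_j` goes to that of `F φ`. -/
def Germ.map (F : C ⥤ D) {Y : IndObj C} {A : C} :
    Y.Germ A → Germ (⟨Y.I, Y.F ⋙ F⟩ : IndObj D) (F.obj A) :=
  Germ.desc (fun j φ => germ (⟨Y.I, Y.F ⋙ F⟩ : IndObj D) j (F.map φ)) (fun {j j'} g φ => by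
    rw [F.map_comp]
    exact germ_map (⟨Y.I, Y.F ⋙ F⟩ : IndObj D) g (F.map φ))

theorem Germ.map_precomp (F : C ⥤ D) {Y : IndObj C} {A A' : C} (a : A' ⟶ A) (x : Y.Germ A) :
    Germ.map F (Germ.precomp a x) = Germ.precomp (F.map a) (Germ.map F x) := by
  obtain ⟨j, φ, rfl⟩ := Y.exists_germ x
  exact congrArg (germ (⟨Y.I, Y.F ⋙ F⟩ : IndObj D) j) (F.map_comp a φ)

end IndObj

open IndObj

/-- The functor `Ind(F) : Ind(C) ⥤ Ind(D)`: it sends `(X_i)` to `(F X_i)` and `(ρ_{ij})` to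
`(F ρ_{ij})`. -/
def indFunctor (F : C ⥤ D) : IndObj C ⥤ IndObj D where
  obj X := ⟨X.I, X.F ⋙ F⟩
  map {X Y} f :=
    { val := fun i => Germ.map F (f.val i)
      compat := fun {i i'} h => by
        rw [← f.compat h, Germ.map_precomp]
        rfl }
  map_id X := Hom.ext (funext fun i =>
    congrArg (germ (⟨X.I, X.F ⋙ F⟩ : IndObj D) i) (F.map_id _))
  map_comp {X Y Z} f g := Hom.ext (funext fun i => by
    change Germ.map F (g.act (f.val i)) = Hom.act _ (Germ.map F (f.val i))
    obtain ⟨j, φ, hφ⟩ := Y.exists_germ (f.val i)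
    rw [← hφ]
    exact Germ.map_precomp F φ (g.val j))

/-- The natural transformation `Ind(α) : Ind(F) ⟶ Ind(G)`, with components `(α_{X_i})`. -/
def indNatTrans {F G : C ⥤ D} (α : F ⟶ G) : indFunctor F ⟶ indFunctor G where
  app X := homOfNatTrans (Functor.whiskerLeft X.F α)
  naturality X Y f := Hom.ext (funext fun i => by
    change Hom.act _ (Germ.map F (f.val i)) = Germ.precomp (α.app (X.F.obj i)) (Germ.map G (f.val i))
    obtain ⟨j, φ, hφ⟩ := Y.exists_germ (f.val i)
    rw [← hφ]
    exact congrArg (germ (⟨Y.I, Y.F ⋙ G⟩ : IndObj D) j) (α.naturality φ))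

theorem indNatTrans_id (F : C ⥤ D) : indNatTrans (𝟙 F) = 𝟙 (indFunctor F) := by
  ext X
  exact Hom.ext (funext fun i => rfl)

theorem indNatTrans_comp {F G H : C ⥤ D} (α : F ⟶ G) (β : G ⟶ H) :
    indNatTrans (α ≫ β) = indNatTrans α ≫ indNatTrans β := by
  ext X
  exact Hom.ext (funext fun i => rfl)

/-- The compositor `φ_{F,G} : Ind(G) ∘ Ind(F) ≅ Ind(G ∘ F)`. Both functors send `(X_i)` to
`(G F X_i)`, and the component of `φ_{F,G}` there is the levelwise identity. -/
def indComp (F : C ⥤ D) (G : D ⥤ E) : indFunctor F ⋙ indFunctor G ≅ indFunctor (F ⋙ G) where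
  hom :=
    { app := fun X => homOfNatTrans (Functor.associator X.F F G).hom
      naturality := fun X Y f => Hom.ext (funext fun i => by
        change Hom.act _ (Germ.map G (Germ.map F (f.val i))) =
          Germ.precomp (𝟙 _) (Germ.map (F ⋙ G) (f.val i))
        obtain ⟨j, φ, hφ⟩ := Y.exists_germ (f.val i)
        rw [← hφ, Germ.precomp_id]
        exact congrArg (germ (⟨Y.I, Y.F ⋙ F ⋙ G⟩ : IndObj E) j) (Category.comp_id _)) }
  inv :=
    { app := fun X => homOfNatTrans (Functor.associator X.F F G).inv
      naturality := fun X Y f => Hom.ext (funext fun i => by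
        change Hom.act _ (Germ.map (F ⋙ G) (f.val i)) =
          Germ.precomp (𝟙 _) (Germ.map G (Germ.map F (f.val i)))
        obtain ⟨j, φ, hφ⟩ := Y.exists_germ (f.val i)
        rw [← hφ, Germ.precomp_id]
        exact congrArg (germ (⟨Y.I, (Y.F ⋙ F) ⋙ G⟩ : IndObj E) j) (Category.comp_id _)) }
  hom_inv_id := by
    ext X
    exact Hom.ext (funext fun i =>
      congrArg (germ (⟨X.I, (X.F ⋙ F) ⋙ G⟩ : IndObj E) i) (Category.comp_id _))
  inv_hom_id := by
    ext X
    exact Hom.ext (funext fun i =>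
      congrArg (germ (⟨X.I, X.F ⋙ F ⋙ G⟩ : IndObj E) i) (Category.comp_id _))

/-- The canonical identification `Ind(id) ≅ id`, which is the levelwise identity. -/
def indId (C : Type u₁) [Category.{v} C] : indFunctor (𝟭 C) ≅ 𝟭 (IndObj C) where
  hom :=
    { app := fun X => homOfNatTrans X.F.rightUnitor.hom
      naturality := fun X Y f => Hom.ext (funext fun i => by
        change Hom.act _ (Germ.map (𝟭 C) (f.val i)) = Germ.precomp (𝟙 _) (f.val i)
        obtain ⟨j, φ, hφ⟩ := Y.exists_germ (f.val i)
        rw [← hφ, Germ.precomp_id]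
        exact congrArg (Y.germ j) (Category.comp_id _)) }
  inv :=
    { app := fun X => homOfNatTrans X.F.rightUnitor.inv
      naturality := fun X Y f => Hom.ext (funext fun i => by
        change Hom.act _ (f.val i) = Germ.precomp (𝟙 _) (Germ.map (𝟭 C) (f.val i))
        obtain ⟨j, φ, hφ⟩ := Y.exists_germ (f.val i)
        rw [← hφ, Germ.precomp_id]
        exact congrArg (germ (⟨Y.I, Y.F ⋙ 𝟭 C⟩ : IndObj C) j) (Category.comp_id _)) }
  hom_inv_id := by
    ext X
    exact Hom.ext (funext fun i =>
      congrArg (germ (⟨X.I, X.F ⋙ 𝟭 C⟩ : IndObj C) i) (Category.comp_id _))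
  inv_hom_id := by
    ext X
    exact Hom.ext (funext fun i => congrArg (X.germ i) (Category.comp_id _))

end Ind


/-! ### Tangent categories -/

section Tangent

variable {C : Type u₁} [Category.{v} C] {D : Type u₂} [Category.{v} D]
  {E : Type u₃} [Category.{v} E]

/-- The functors and natural transformations `(T, p, 0, +, ℓ, c)` of a tangent structure. The
functor `T₂` with its two projections stands for the pullback of `p` along itself, which is
imposed below. -/
structure TangentData (C : Type u₁) [Category.{v} C] where
  /-- the tangent functor -/
  T : C ⥤ C
  /-- the bundle projection -/
  p : T ⟶ 𝟭 C
  /-- the fibred square `X ↦ TX ×_X TX` of the tangent bundle -/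
  T₂ : C ⥤ C
  /-- the first projection -/
  π₁ : T₂ ⟶ T
  /-- the second projection -/
  π₂ : T₂ ⟶ T
  /-- the zero section -/
  zero : 𝟭 C ⟶ T
  /-- the fibrewise addition -/
  add : T₂ ⟶ T
  /-- the vertical lift -/
  ℓ : T ⟶ T ⋙ T
  /-- the canonical flip -/
  c : T ⋙ T ⟶ T ⋙ T

/-- The `n`-fold composite `Tⁿ` of an endofunctor. -/
def iter (T : C ⥤ C) : ℕ → (C ⥤ C)
  | 0 => 𝟭 C
  | n + 1 => iter T n ⋙ T

/-- The diagram of `n` copies of `p_X : TX ⟶ X`, whose limit is the `n`-th pullback power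
of `p_X`. -/
abbrev TangentData.powerDiagram (t : TangentData C) (n : ℕ) (X : C) :
    WidePullbackShape (Fin n) ⥤ C :=
  WidePullbackShape.wideCospan X (fun _ => t.T.obj X) (fun _ => t.p.app X)

/-- `T₂` is the pullback of `p` along itself, all pullback powers of `p_X` exist, and all `Tᵐ`
preserve them. -/
structure HasTangentPullbacks (t : TangentData C) : Prop where
  isPullback (X : C) : IsPullback (t.π₁.app X) (t.π₂.app X) (t.p.app X) (t.p.app X)
  hasLimit_power (n : ℕ) (X : C) : HasLimit (t.powerDiagram n X)
  preserves_power (m n : ℕ) (X : C) : PreservesLimit (t.powerDiagram n X) (iter t.T m)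

namespace HasTangentPullbacks

variable {t : TangentData C}

/-- The pairing `⟨x, y⟩ : Z ⟶ T₂X`. -/
noncomputable def pair (h : HasTangentPullbacks t) {X Z : C} (x y : Z ⟶ t.T.obj X)
    (e : x ≫ t.p.app X = y ≫ t.p.app X) : Z ⟶ t.T₂.obj X :=
  (h.isPullback X).lift x y e

theorem pair_π₁ (h : HasTangentPullbacks t) {X Z : C} (x y : Z ⟶ t.T.obj X)
    (e : x ≫ t.p.app X = y ≫ t.p.app X) : h.pair x y e ≫ t.π₁.app X = x :=
  (h.isPullback X).lift_fst x y e

theorem pair_π₂ (h : HasTangentPullbacks t) {X Z : C} (x y : Z ⟶ t.T.obj X)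
    (e : x ≫ t.p.app X = y ≫ t.p.app X) : h.pair x y e ≫ t.π₂.app X = y :=
  (h.isPullback X).lift_snd x y e

theorem hom_ext (h : HasTangentPullbacks t) {X Z : C} {x y : Z ⟶ t.T₂.obj X}
    (h₁ : x ≫ t.π₁.app X = y ≫ t.π₁.app X) (h₂ : x ≫ t.π₂.app X = y ≫ t.π₂.app X) : x = y :=
  (h.isPullback X).hom_ext h₁ h₂

/-- `T₂X` as the second pullback power of `p_X`. -/
def powerCone (h : HasTangentPullbacks t) (X : C) : Cone (t.powerDiagram 2 X) :=
  WidePullbackShape.mkCone (F := t.powerDiagram 2 X) (X := t.T₂.obj X) (t.π₁.app X ≫ t.p.app X)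
    (fun j => Fin.cases (t.π₁.app X) (fun _ => t.π₂.app X) j)
    (fun j => Fin.cases rfl (fun _ => (h.isPullback X).w.symm) j)

theorem cone_w {X : C} (s : Cone (t.powerDiagram 2 X)) (j : Fin 2) :
    s.π.app (some j) ≫ t.p.app X = s.π.app none :=
  s.w (WidePullbackShape.Hom.term j)

/-- `T₂X` is the second pullback power of `p_X`. -/
noncomputable def powerConeIsLimit (h : HasTangentPullbacks t) (X : C) :
    IsLimit (h.powerCone X) where
  lift s := h.pair (s.π.app (some 0)) (s.π.app (some 1)) ((cone_w s 0).trans (cone_w s 1).symm)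
  fac s j := by
    match j with
    | none =>
      exact (Category.assoc _ _ _).symm.trans
        ((congrArg (· ≫ t.p.app X) (h.pair_π₁ _ _ _)).trans (cone_w s 0))
    | some ⟨0, _⟩ => exact h.pair_π₁ _ _ _
    | some ⟨1, _⟩ => exact h.pair_π₂ _ _ _
  uniq s m hm := by
    apply h.hom_ext
    · exact (hm (some 0)).trans (h.pair_π₁ _ _ _).symm
    · exact (hm (some 1)).trans (h.pair_π₂ _ _ _).symm

/-- `T(T₂X)` is the pullback of `T(p_X)` along itself. -/
theorem map_isPullback (h : HasTangentPullbacks t) (X : C) :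
    IsPullback (t.T.map (t.π₁.app X)) (t.T.map (t.π₂.app X)) (t.T.map (t.p.app X))
      (t.T.map (t.p.app X)) := by
  have hp : PreservesLimit (t.powerDiagram 2 X) (iter t.T 1) := h.preserves_power 1 2 X
  have hl : IsLimit ((iter t.T 1).mapCone (h.powerCone X)) :=
    isLimitOfPreserves (iter t.T 1) (h.powerConeIsLimit X)
  have w : t.T.map (t.π₁.app X) ≫ t.T.map (t.p.app X) =
      t.T.map (t.π₂.app X) ≫ t.T.map (t.p.app X) := by
    rw [← t.T.map_comp, ← t.T.map_comp, (h.isPullback X).w]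
  let K (s : PullbackCone (t.T.map (t.p.app X)) (t.T.map (t.p.app X))) :
      Cone (t.powerDiagram 2 X ⋙ iter t.T 1) :=
    WidePullbackShape.mkCone (F := t.powerDiagram 2 X ⋙ iter t.T 1) (X := s.pt)
      (s.fst ≫ t.T.map (t.p.app X))
      (fun j => Fin.cases s.fst (fun _ => s.snd) j)
      (fun j => Fin.cases rfl (fun _ => s.condition.symm) j)
  refine ⟨⟨w⟩, ⟨PullbackCone.IsLimit.mk w (fun s => hl.lift (K s)) (fun s => hl.fac (K s) (some 0))
    (fun s => hl.fac (K s) (some 1)) (fun s m h₁ h₂ => ?_)⟩⟩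
  refine hl.uniq (K s) m (fun j => ?_)
  match j with
  | none =>
    change m ≫ t.T.map (t.π₁.app X ≫ t.p.app X) = s.fst ≫ t.T.map (t.p.app X)
    rw [t.T.map_comp, ← h₁, Category.assoc]
  | some ⟨0, _⟩ => exact h₁
  | some ⟨1, _⟩ => exact h₂

/-- The pairing `⟨x, y⟩ : Z ⟶ T(T₂X)` of two morphisms to `T²X` that agree over `T(p_X)`. -/
noncomputable def mapPair (h : HasTangentPullbacks t) {X Z : C} (x y : Z ⟶ t.T.obj (t.T.obj X))
    (e : x ≫ t.T.map (t.p.app X) = y ≫ t.T.map (t.p.app X)) : Z ⟶ t.T.obj (t.T₂.obj X) :=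
  (h.map_isPullback X).lift x y e

end HasTangentPullbacks

/-- The axioms of a tangent structure. Because of `ℓ_c` and `c_add`, the axiom `ℓ_add` can be stated
equivalently with the fibrewise addition of `T²X` over `p_{TX}` (as here) or over `T(p_X)`. -/
structure IsTangent (t : TangentData C) : Prop extends HasTangentPullbacks t where
  /- `p_X : TX ⟶ X` is a commutative monoid over `X` with unit `0_X` and addition `+_X`;
  associativity is stated on generalized elements -/
  zero_p (X : C) : t.zero.app X ≫ t.p.app X = 𝟙 X
  add_p (X : C) : t.add.app X ≫ t.p.app X = t.π₁.app X ≫ t.p.app X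
  zero_add (X : C) :
    toHasTangentPullbacks.pair (t.p.app X ≫ t.zero.app X) (𝟙 (t.T.obj X))
      (by have := zero_p X; simp_all) ≫ t.add.app X = 𝟙 (t.T.obj X)
  add_comm (X : C) :
    toHasTangentPullbacks.pair (t.π₂.app X) (t.π₁.app X) (isPullback X).w.symm ≫ t.add.app X =
      t.add.app X
  add_assoc {X Z : C} (x y z : Z ⟶ t.T.obj X) (hxy : x ≫ t.p.app X = y ≫ t.p.app X)
    (hyz : y ≫ t.p.app X = z ≫ t.p.app X) :
    toHasTangentPullbacks.pair (toHasTangentPullbacks.pair x y hxy ≫ t.add.app X) z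
      (by rw [Category.assoc, add_p, ← Category.assoc, toHasTangentPullbacks.pair_π₁, hxy, hyz]) ≫
        t.add.app X =
    toHasTangentPullbacks.pair x (toHasTangentPullbacks.pair y z hyz ≫ t.add.app X)
      (by rw [Category.assoc, add_p, ← Category.assoc, toHasTangentPullbacks.pair_π₁, hxy]) ≫
        t.add.app X
  /- `(c_X, id_{TX})` is a morphism of additive bundles -/
  c_p (X : C) : t.c.app X ≫ t.p.app (t.T.obj X) = t.T.map (t.p.app X)
  c_add (X : C) :
    t.T.map (t.add.app X) ≫ t.c.app X =
      toHasTangentPullbacks.pair (X := t.T.obj X) (t.T.map (t.π₁.app X) ≫ t.c.app X)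
        (t.T.map (t.π₂.app X) ≫ t.c.app X)
        (by rw [Category.assoc, Category.assoc, c_p, ← t.T.map_comp, ← t.T.map_comp,
          (isPullback X).w]) ≫ t.add.app (t.T.obj X)
  c_zero (X : C) : t.T.map (t.zero.app X) ≫ t.c.app X = t.zero.app (t.T.obj X)
  c_c (X : C) : t.c.app X ≫ t.c.app X = 𝟙 (t.T.obj (t.T.obj X))
  ℓ_c (X : C) : t.ℓ.app X ≫ t.c.app X = t.ℓ.app X
  /- `(ℓ_X, 0_X)` is a morphism of additive bundles -/
  ℓ_p (X : C) : t.ℓ.app X ≫ t.T.map (t.p.app X) = t.p.app X ≫ t.zero.app X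
  ℓ_add (X : C) :
    t.add.app X ≫ t.ℓ.app X =
      toHasTangentPullbacks.pair (X := t.T.obj X) (t.π₁.app X ≫ t.ℓ.app X)
        (t.π₂.app X ≫ t.ℓ.app X)
        (by
          have h : t.ℓ.app X ≫ t.p.app (t.T.obj X) = t.p.app X ≫ t.zero.app X := by
            rw [← ℓ_p, ← c_p, ← Category.assoc, ℓ_c]
          rw [Category.assoc, Category.assoc, h, ← Category.assoc, ← Category.assoc,
            (isPullback X).w]) ≫ t.add.app (t.T.obj X)
  ℓ_zero (X : C) : t.zero.app X ≫ t.ℓ.app X = t.zero.app X ≫ t.zero.app (t.T.obj X)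
  /- the coherences between `ℓ` and `c` -/
  ℓ_ℓ (X : C) : t.ℓ.app X ≫ t.T.map (t.ℓ.app X) = t.ℓ.app X ≫ t.ℓ.app (t.T.obj X)
  c_braid (X : C) :
    t.T.map (t.c.app X) ≫ t.c.app (t.T.obj X) ≫ t.T.map (t.c.app X) =
      t.c.app (t.T.obj X) ≫ t.T.map (t.c.app X) ≫ t.c.app (t.T.obj X)
  c_ℓ (X : C) :
    t.ℓ.app (t.T.obj X) ≫ t.T.map (t.c.app X) ≫ t.c.app (t.T.obj X) =
      t.c.app X ≫ t.T.map (t.ℓ.app X)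
  /- the universality of the vertical lift: `T(+) ∘ ⟨ℓ ∘ π₁, 0_T ∘ π₂⟩` is an equalizer of
  `T(p)` and `0 ∘ p ∘ p_T` -/
  isEqualizer (X : C) :
    ∃ w : (toHasTangentPullbacks.mapPair (X := X) (t.π₁.app X ≫ t.ℓ.app X)
          (t.π₂.app X ≫ t.zero.app (t.T.obj X))
          (by
            have h : t.zero.app (t.T.obj X) ≫ t.T.map (t.p.app X) = t.p.app X ≫ t.zero.app X :=
              (t.zero.naturality (t.p.app X)).symm
            rw [Category.assoc, Category.assoc, h, ℓ_p, ← Category.assoc, ← Category.assoc,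
              (isPullback X).w]) ≫ t.T.map (t.add.app X)) ≫ t.T.map (t.p.app X) =
        (toHasTangentPullbacks.mapPair (X := X) (t.π₁.app X ≫ t.ℓ.app X)
          (t.π₂.app X ≫ t.zero.app (t.T.obj X)) _ ≫ t.T.map (t.add.app X)) ≫
          t.p.app (t.T.obj X) ≫ t.p.app X ≫ t.zero.app X,
      Nonempty (IsLimit (Fork.ofι _ w))

/-- A tangent structure on a category. -/
structure TangentStructure (C : Type u₁) [Category.{v} C] extends TangentData C where
  isTangent : IsTangent toTangentData

/-- `(F, α)` is a morphism of tangent categories, where `α : F ∘ T ⟶ S ∘ F`. -/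
structure IsTangentMorphism (t : TangentStructure C) (s : TangentStructure D) (F : C ⥤ D)
    (α : t.T ⋙ F ⟶ F ⋙ s.T) : Prop where
  p (X : C) : α.app X ≫ s.p.app (F.obj X) = F.map (t.p.app X)
  zero (X : C) : F.map (t.zero.app X) ≫ α.app X = s.zero.app (F.obj X)
  add (X : C) :
    F.map (t.add.app X) ≫ α.app X =
      s.isTangent.pair (X := F.obj X) (F.map (t.π₁.app X) ≫ α.app X)
        (F.map (t.π₂.app X) ≫ α.app X)
        (by rw [Category.assoc, Category.assoc, p, ← F.map_comp, ← F.map_comp,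
          (t.isTangent.isPullback X).w]) ≫ s.add.app (F.obj X)
  ℓ (X : C) :
    α.app X ≫ s.ℓ.app (F.obj X) =
      F.map (t.ℓ.app X) ≫ α.app (t.T.obj X) ≫ s.T.map (α.app X)
  c (X : C) :
    (α.app (t.T.obj X) ≫ s.T.map (α.app X)) ≫ s.c.app (F.obj X) =
      F.map (t.c.app X) ≫ α.app (t.T.obj X) ≫ s.T.map (α.app X)

/-- `(F, α)` is a strong tangent morphism: `α` is invertible and `F` preserves the pullback powers
and the equalizers of the tangent structure of its domain. -/
structure IsStrongTangentMorphism (t : TangentStructure C) (s : TangentStructure D) (F : C ⥤ D)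
    (α : t.T ⋙ F ⟶ F ⋙ s.T) : Prop extends IsTangentMorphism t s F α where
  isIso : IsIso α
  preserves_power (n : ℕ) (X : C) : PreservesLimit (t.powerDiagram n X) F
  preserves_equalizer (X : C) :
    PreservesLimit (parallelPair (t.T.map (t.p.app X))
      (t.p.app (t.T.obj X) ≫ t.p.app X ≫ t.zero.app X)) F

/-- A natural transformation `ρ : F ⟶ G` is a tangent transformation `(F, α) ⟶ (G, β)`. -/
def IsTangentTransformation (t : TangentStructure C) (s : TangentStructure D) {F G : C ⥤ D}
    (α : t.T ⋙ F ⟶ F ⋙ s.T) (β : t.T ⋙ G ⟶ G ⋙ s.T) (ρ : F ⟶ G) : Prop :=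
  ∀ X : C, α.app X ≫ s.T.map (ρ.app X) = ρ.app (t.T.obj X) ≫ β.app X

/-- The natural transformation `(β ∗ F) ∘ (G ∗ α) : G ∘ F ∘ T ⟶ R ∘ G ∘ F`. -/
def compHat {T : C ⥤ C} {S : D ⥤ D} {R : E ⥤ E} {F : C ⥤ D} {G : D ⥤ E}
    (α : T ⋙ F ⟶ F ⋙ S) (β : S ⋙ G ⟶ G ⋙ R) : T ⋙ F ⋙ G ⟶ (F ⋙ G) ⋙ R where
  app A := G.map (α.app A) ≫ β.app (F.obj A)
  naturality A B a := by
    have h₁ : F.map (T.map a) ≫ α.app B = α.app A ≫ S.map (F.map a) := α.naturality a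
    have h₂ : G.map (S.map (F.map a)) ≫ β.app (F.obj B) =
        β.app (F.obj A) ≫ R.map (G.map (F.map a)) := β.naturality (F.map a)
    change G.map (F.map (T.map a)) ≫ G.map (α.app B) ≫ β.app (F.obj B) =
      (G.map (α.app A) ≫ β.app (F.obj A)) ≫ R.map (G.map (F.map a))
    rw [← Category.assoc, ← G.map_comp, h₁, G.map_comp, Category.assoc, h₂, Category.assoc]

namespace IsTangentMorphism

variable {t : TangentStructure C} {s : TangentStructure D} {r : TangentStructure E}
  {F : C ⥤ D} {G : D ⥤ E} {α : t.T ⋙ F ⟶ F ⋙ s.T} {β : s.T ⋙ G ⟶ G ⋙ r.T}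

theorem comp_p (hα : IsTangentMorphism t s F α) (hβ : IsTangentMorphism s r G β) (A : C) :
    (G.map (α.app A) ≫ β.app (F.obj A)) ≫ r.p.app (G.obj (F.obj A)) =
      G.map (F.map (t.p.app A)) := by
  rw [Category.assoc, hβ.p, ← G.map_comp, hα.p]

theorem comp_zero (hα : IsTangentMorphism t s F α) (hβ : IsTangentMorphism s r G β) (A : C) :
    G.map (F.map (t.zero.app A)) ≫ G.map (α.app A) ≫ β.app (F.obj A) =
      r.zero.app (G.obj (F.obj A)) := by
  rw [← Category.assoc, ← G.map_comp, hα.zero, hβ.zero]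

theorem comp_add (hα : IsTangentMorphism t s F α) (hβ : IsTangentMorphism s r G β) (A : C)
    (e : (G.map (F.map (t.π₁.app A)) ≫ G.map (α.app A) ≫ β.app (F.obj A)) ≫
        r.p.app (G.obj (F.obj A)) =
      (G.map (F.map (t.π₂.app A)) ≫ G.map (α.app A) ≫ β.app (F.obj A)) ≫
        r.p.app (G.obj (F.obj A))) :
    G.map (F.map (t.add.app A)) ≫ G.map (α.app A) ≫ β.app (F.obj A) =
      r.isTangent.pair (X := G.obj (F.obj A))
        (G.map (F.map (t.π₁.app A)) ≫ G.map (α.app A) ≫ β.app (F.obj A))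
        (G.map (F.map (t.π₂.app A)) ≫ G.map (α.app A) ≫ β.app (F.obj A)) e ≫
          r.add.app (G.obj (F.obj A)) := by
  rw [← Category.assoc, ← G.map_comp, hα.add, G.map_comp, Category.assoc, hβ.add, ← Category.assoc]
  refine congrArg (· ≫ r.add.app (G.obj (F.obj A))) ?_
  apply r.isTangent.hom_ext
  · rw [Category.assoc, r.isTangent.pair_π₁, ← Category.assoc, ← G.map_comp,
      s.isTangent.pair_π₁, G.map_comp, Category.assoc, r.isTangent.pair_π₁]
  · rw [Category.assoc, r.isTangent.pair_π₂, ← Category.assoc, ← G.map_comp,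
      s.isTangent.pair_π₂, G.map_comp, Category.assoc, r.isTangent.pair_π₂]

theorem comp_ℓ (hα : IsTangentMorphism t s F α) (hβ : IsTangentMorphism s r G β) (A : C) :
    (G.map (α.app A) ≫ β.app (F.obj A)) ≫ r.ℓ.app (G.obj (F.obj A)) =
      G.map (F.map (t.ℓ.app A)) ≫ (G.map (α.app (t.T.obj A)) ≫ β.app (F.obj (t.T.obj A))) ≫
        r.T.map (G.map (α.app A) ≫ β.app (F.obj A)) := by
  have h : G.map (s.T.map (α.app A)) ≫ β.app (s.T.obj (F.obj A)) =
      β.app (F.obj (t.T.obj A)) ≫ r.T.map (G.map (α.app A)) := β.naturality (α.app A)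
  have hf : G.map (α.app A) ≫ G.map (s.ℓ.app (F.obj A)) =
      G.map (F.map (t.ℓ.app A)) ≫ G.map (α.app (t.T.obj A)) ≫ G.map (s.T.map (α.app A)) := by
    rw [← G.map_comp, hα.ℓ, G.map_comp, G.map_comp]
  rw [Category.assoc, hβ.ℓ, ← Category.assoc, hf, r.T.map_comp, Category.assoc, Category.assoc,
    Category.assoc, reassoc_of% h]

theorem comp_c (hα : IsTangentMorphism t s F α) (hβ : IsTangentMorphism s r G β) (A : C) :
    ((G.map (α.app (t.T.obj A)) ≫ β.app (F.obj (t.T.obj A))) ≫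
        r.T.map (G.map (α.app A) ≫ β.app (F.obj A))) ≫ r.c.app (G.obj (F.obj A)) =
      G.map (F.map (t.c.app A)) ≫ (G.map (α.app (t.T.obj A)) ≫ β.app (F.obj (t.T.obj A))) ≫
        r.T.map (G.map (α.app A) ≫ β.app (F.obj A)) := by
  have h : G.map (s.T.map (α.app A)) ≫ β.app (s.T.obj (F.obj A)) =
      β.app (F.obj (t.T.obj A)) ≫ r.T.map (G.map (α.app A)) := β.naturality (α.app A)
  have hf : G.map (α.app (t.T.obj A)) ≫ G.map (s.T.map (α.app A)) ≫ G.map (s.c.app (F.obj A)) =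
      G.map (F.map (t.c.app A)) ≫ G.map (α.app (t.T.obj A)) ≫ G.map (s.T.map (α.app A)) := by
    rw [← G.map_comp, ← G.map_comp, ← G.map_comp, ← G.map_comp, ← Category.assoc, hα.c]
  have hg := hβ.c (F.obj A)
  rw [Category.assoc] at hg
  rw [r.T.map_comp, Category.assoc, Category.assoc, Category.assoc, Category.assoc,
    ← reassoc_of% h, hg, reassoc_of% hf, reassoc_of% h]

/-- Tangent morphisms compose. -/
theorem comp (hα : IsTangentMorphism t s F α) (hβ : IsTangentMorphism s r G β) :
    IsTangentMorphism t r (F ⋙ G) (compHat α β) where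
  p := hα.comp_p hβ
  zero := hα.comp_zero hβ
  add A := hα.comp_add hβ A _
  ℓ := hα.comp_ℓ hβ
  c := hα.comp_c hβ

end IsTangentMorphism

/-! ### The ind-tangent structure -/

/-- The data `(Ind(T), Ind(p), Ind(0), Ind(+), φ⁻¹ ∘ Ind(ℓ), φ⁻¹ ∘ Ind(c) ∘ φ)` on `Ind(C)`. The
fibred square of `Ind(p)` is represented by `Ind(T₂)`. -/
def TangentData.ind (t : TangentData C) : TangentData (IndObj C) where
  T := indFunctor t.T
  p := indNatTrans t.p ≫ (indId C).hom
  T₂ := indFunctor t.T₂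
  π₁ := indNatTrans t.π₁
  π₂ := indNatTrans t.π₂
  zero := (indId C).inv ≫ indNatTrans t.zero
  add := indNatTrans t.add
  ℓ := indNatTrans t.ℓ ≫ (indComp t.T t.T).inv
  c := (indComp t.T t.T).hom ≫ indNatTrans t.c ≫ (indComp t.T t.T).inv

/-- The ind-tangent structure. -/
def TangentStructure.ind (t : TangentStructure C) (h : IsTangent t.toTangentData.ind) :
    TangentStructure (IndObj C) where
  toTangentData := t.toTangentData.ind
  isTangent := h

/-- The natural transformation `α̂ = φ⁻¹ ∘ Ind(α) ∘ φ : Ind(F) ∘ Ind(T) ⟶ Ind(S) ∘ Ind(F)`. -/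
def indHat {T : C ⥤ C} {S : D ⥤ D} {F : C ⥤ D} (α : T ⋙ F ⟶ F ⋙ S) :
    indFunctor T ⋙ indFunctor F ⟶ indFunctor F ⋙ indFunctor S :=
  (indComp T F).hom ≫ indNatTrans α ≫ (indComp F S).inv

end Tangent

/-! ### The 2-category of tangent categories -/

/-- A tangent category. -/
structure TanCat : Type (max (u + 1) (v + 1)) where
  /-- the underlying type of objects -/
  carrier : Type u
  [category : Category.{v} carrier]
  /-- the tangent structure -/
  str : TangentStructure carrier

attribute [instance] TanCat.category

namespace TanCat

/-- A morphism of tangent categories. -/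
structure Hom (X Y : TanCat.{v, u}) where
  /-- the underlying functor -/
  F : X.carrier ⥤ Y.carrier
  /-- the natural transformation `F ∘ T ⟶ S ∘ F` -/
  α : X.str.T ⋙ F ⟶ F ⋙ Y.str.T
  isTangentMorphism : IsTangentMorphism X.str Y.str F α

/-- A tangent transformation. -/
@[ext]
structure Hom₂ {X Y : TanCat.{v, u}} (f g : Hom X Y) where
  /-- the underlying natural transformation -/
  ρ : f.F ⟶ g.F
  isTangentTransformation : IsTangentTransformation X.str Y.str f.α g.α ρ

/-- The identity morphism. -/
def Hom.id (X : TanCat.{v, u}) : Hom X X where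
  F := 𝟭 X.carrier
  α := 𝟙 X.str.T
  isTangentMorphism :=
    { p := fun A => Category.id_comp _
      zero := fun A => Category.comp_id _
      add := fun A => by
        refine (Category.comp_id (X.str.add.app A)).trans
          ((Category.id_comp (X.str.add.app A)).symm.trans
            (congrArg (· ≫ X.str.add.app A) ?_))
        apply X.str.isTangent.hom_ext
        · refine (Category.id_comp _).trans (Eq.trans ?_ (X.str.isTangent.pair_π₁ _ _ _).symm)
          exact (Category.comp_id _).symm
        · refine (Category.id_comp _).trans (Eq.trans ?_ (X.str.isTangent.pair_π₂ _ _ _).symm)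
          exact (Category.comp_id _).symm
      ℓ := fun A => by
        change 𝟙 (X.str.T.obj A) ≫ X.str.ℓ.app A =
          X.str.ℓ.app A ≫ 𝟙 (X.str.T.obj (X.str.T.obj A)) ≫ X.str.T.map (𝟙 (X.str.T.obj A))
        rw [X.str.T.map_id, Category.id_comp]
        exact ((congrArg (X.str.ℓ.app A ≫ ·) (Category.id_comp _)).trans (Category.comp_id _)).symm
      c := fun A => by
        have h : 𝟙 (X.str.T.obj (X.str.T.obj A)) ≫ X.str.T.map (𝟙 (X.str.T.obj A)) =
            𝟙 (X.str.T.obj (X.str.T.obj A)) := by rw [X.str.T.map_id, Category.id_comp]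
        change (𝟙 (X.str.T.obj (X.str.T.obj A)) ≫ X.str.T.map (𝟙 (X.str.T.obj A))) ≫
          X.str.c.app A = X.str.c.app A ≫
            𝟙 (X.str.T.obj (X.str.T.obj A)) ≫ X.str.T.map (𝟙 (X.str.T.obj A))
        rw [h]
        exact (Category.id_comp (X.str.c.app A)).trans (Category.comp_id (X.str.c.app A)).symm }

/-- The composite `(G ∘ F, (β ∗ F) ∘ (G ∗ α))` of `(F, α)` and `(G, β)`. -/
def Hom.comp {X Y Z : TanCat.{v, u}} (f : Hom X Y) (g : Hom Y Z) : Hom X Z where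
  F := f.F ⋙ g.F
  α := compHat f.α g.α
  isTangentMorphism := f.isTangentMorphism.comp g.isTangentMorphism

instance instCategoryStruct : CategoryStruct TanCat.{v, u} where
  Hom X Y := Hom X Y
  id X := Hom.id X
  comp f g := Hom.comp f g

instance instHomCategory (X Y : TanCat.{v, u}) : Category (X ⟶ Y) where
  Hom f g := Hom₂ f g
  id f :=
    { ρ := 𝟙 f.F
      isTangentTransformation := fun A => by
        change f.α.app A ≫ Y.str.T.map (𝟙 (f.F.obj A)) = 𝟙 (f.F.obj (X.str.T.obj A)) ≫ f.α.app A
        rw [Y.str.T.map_id, Category.id_comp]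
        exact Category.comp_id _ }
  comp {f g h} r s :=
    { ρ := r.ρ ≫ s.ρ
      isTangentTransformation := fun A => by
        have h₁ := r.isTangentTransformation A
        have h₂ := s.isTangentTransformation A
        rw [NatTrans.comp_app, NatTrans.comp_app, Y.str.T.map_comp, ← Category.assoc, h₁,
          Category.assoc, h₂, Category.assoc] }
  id_comp r := Hom₂.ext (Category.id_comp r.ρ)
  comp_id r := Hom₂.ext (Category.comp_id r.ρ)
  assoc r s t := Hom₂.ext (Category.assoc r.ρ s.ρ t.ρ)

/-- An invertible tangent transformation from a natural isomorphism. -/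
def isoMk {X Y : TanCat.{v, u}} {f g : X ⟶ Y} (e : Hom.F f ≅ Hom.F g)
    (h : IsTangentTransformation X.str Y.str (Hom.α f) (Hom.α g) e.hom)
    (h' : IsTangentTransformation X.str Y.str (Hom.α g) (Hom.α f) e.inv) : f ≅ g where
  hom := { ρ := e.hom, isTangentTransformation := h }
  inv := { ρ := e.inv, isTangentTransformation := h' }
  hom_inv_id := Hom₂.ext e.hom_inv_id
  inv_hom_id := Hom₂.ext e.inv_hom_id

/-- The 2-category of tangent categories, tangent morphisms and tangent transformations. -/
instance : Bicategory TanCat.{v, u} where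
  toCategoryStruct := instCategoryStruct
  homCategory := instHomCategory
  whiskerLeft {X Y Z} f g h r :=
    { ρ := Functor.whiskerLeft (Hom.F f) (Hom₂.ρ r)
      isTangentTransformation := fun A => by
        have h₁ := Hom₂.isTangentTransformation r (f.F.obj A)
        have h₂ := (Hom₂.ρ r).naturality (f.α.app A)
        change (g.F.map (f.α.app A) ≫ g.α.app (f.F.obj A)) ≫
          Z.str.T.map ((Hom₂.ρ r).app (f.F.obj A)) =
            (Hom₂.ρ r).app (f.F.obj (X.str.T.obj A)) ≫ h.F.map (f.α.app A) ≫ h.α.app (f.F.obj A)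
        rw [Category.assoc, h₁, ← Category.assoc]
        exact (congrArg (· ≫ h.α.app (f.F.obj A)) h₂).trans (Category.assoc _ _ _) }
  whiskerRight {X Y Z f g} r h :=
    { ρ := Functor.whiskerRight (Hom₂.ρ r) (Hom.F h)
      isTangentTransformation := fun A => by
        have h₁ := congrArg h.F.map (Hom₂.isTangentTransformation r A)
        have h₂ : h.F.map (Y.str.T.map ((Hom₂.ρ r).app A)) ≫ h.α.app (g.F.obj A) =
          h.α.app (f.F.obj A) ≫ Z.str.T.map (h.F.map ((Hom₂.ρ r).app A)) :=
            h.α.naturality ((Hom₂.ρ r).app A)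
        change (h.F.map (f.α.app A) ≫ h.α.app (f.F.obj A)) ≫
          Z.str.T.map (h.F.map ((Hom₂.ρ r).app A)) =
            h.F.map ((Hom₂.ρ r).app (X.str.T.obj A)) ≫ h.F.map (g.α.app A) ≫ h.α.app (g.F.obj A)
        simp only [Functor.map_comp] at h₁
        rw [Category.assoc, ← h₂, reassoc_of% h₁] }
  associator {W X Y Z} f g h :=
    isoMk (Functor.associator (Hom.F f) (Hom.F g) (Hom.F h))
      (fun A => by
        change (h.F.map (g.F.map (f.α.app A) ≫ g.α.app (f.F.obj A)) ≫
          h.α.app (g.F.obj (f.F.obj A))) ≫ Z.str.T.map (𝟙 (h.F.obj (g.F.obj (f.F.obj A)))) =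
          𝟙 (h.F.obj (g.F.obj (f.F.obj (W.str.T.obj A)))) ≫ h.F.map (g.F.map (f.α.app A)) ≫
            h.F.map (g.α.app (f.F.obj A)) ≫ h.α.app (g.F.obj (f.F.obj A))
        simp)
      (fun A => by
        change (h.F.map (g.F.map (f.α.app A)) ≫ h.F.map (g.α.app (f.F.obj A)) ≫
          h.α.app (g.F.obj (f.F.obj A))) ≫ Z.str.T.map (𝟙 (h.F.obj (g.F.obj (f.F.obj A)))) =
          𝟙 (h.F.obj (g.F.obj (f.F.obj (W.str.T.obj A)))) ≫
            h.F.map (g.F.map (f.α.app A) ≫ g.α.app (f.F.obj A)) ≫ h.α.app (g.F.obj (f.F.obj A))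
        simp)
  leftUnitor {X Y} f :=
    isoMk (Functor.leftUnitor (Hom.F f))
      (fun A => by
        change (f.F.map (𝟙 (X.str.T.obj A)) ≫ f.α.app A) ≫ Y.str.T.map (𝟙 (f.F.obj A)) =
          𝟙 (f.F.obj (X.str.T.obj A)) ≫ f.α.app A
        simp)
      (fun A => by
        change f.α.app A ≫ Y.str.T.map (𝟙 (f.F.obj A)) =
          𝟙 (f.F.obj (X.str.T.obj A)) ≫ f.F.map (𝟙 (X.str.T.obj A)) ≫ f.α.app A
        simp)
  rightUnitor {X Y} f :=
    isoMk (Functor.rightUnitor (Hom.F f))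
      (fun A => by
        change (f.α.app A ≫ 𝟙 (Y.str.T.obj (f.F.obj A))) ≫ Y.str.T.map (𝟙 (f.F.obj A)) =
          𝟙 (f.F.obj (X.str.T.obj A)) ≫ f.α.app A
        simp)
      (fun A => by
        change f.α.app A ≫ Y.str.T.map (𝟙 (f.F.obj A)) =
          𝟙 (f.F.obj (X.str.T.obj A)) ≫ f.α.app A ≫ 𝟙 (Y.str.T.obj (f.F.obj A))
        simp)
  whiskerLeft_id _ _ := Hom₂.ext (NatTrans.ext (funext fun _ => rfl))
  whiskerLeft_comp _ _ _ _ _ _ := Hom₂.ext (NatTrans.ext (funext fun _ => rfl))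
  id_whiskerLeft r := Hom₂.ext (NatTrans.ext (funext fun A =>
    ((Category.id_comp _).trans (Category.comp_id _)).symm))
  comp_whiskerLeft _ _ _ _ _ := Hom₂.ext (NatTrans.ext (funext fun A =>
    ((Category.id_comp _).trans (Category.comp_id _)).symm))
  id_whiskerRight _ h := Hom₂.ext (NatTrans.ext (funext fun _ => (Hom.F h).map_id _))
  comp_whiskerRight _ _ h := Hom₂.ext (NatTrans.ext (funext fun _ => (Hom.F h).map_comp _ _))
  whiskerRight_id r := Hom₂.ext (NatTrans.ext (funext fun A =>
    ((Category.id_comp _).trans (Category.comp_id _)).symm))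
  whiskerRight_comp _ _ _ := Hom₂.ext (NatTrans.ext (funext fun A =>
    ((Category.id_comp _).trans (Category.comp_id _)).symm))
  whisker_assoc _ _ _ _ _ := Hom₂.ext (NatTrans.ext (funext fun A =>
    ((Category.id_comp _).trans (Category.comp_id _)).symm))
  whisker_exchange _ s := Hom₂.ext (NatTrans.ext (funext fun A => ((Hom₂.ρ s).naturality _).symm))
  pentagon f g h i := Hom₂.ext (NatTrans.ext (funext fun A => by
    change i.F.map (𝟙 _) ≫ 𝟙 _ ≫ 𝟙 _ = 𝟙 _ ≫ 𝟙 _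
    simp))
  triangle f g := Hom₂.ext (NatTrans.ext (funext fun A => by
    change 𝟙 _ ≫ 𝟙 _ = g.F.map (𝟙 _)
    simp))

/-- The forgetful 2-functor to categories. -/
def forget : Pseudofunctor TanCat.{v, u} Cat.{v, u} where
  obj X := Cat.of X.carrier
  map f := (Hom.F f).toCatHom
  map₂ r := (Hom₂.ρ r).toCatHom₂
  mapId _ := Iso.refl _
  mapComp _ _ := Iso.refl _
  map₂_id _ := rfl
  map₂_comp _ _ := rfl
  map₂_whisker_left f _ _ r := Cat.Hom₂.ext (NatTrans.ext (funext fun A =>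
    ((Category.id_comp _).trans (Category.comp_id _)).symm))
  map₂_whisker_right r h := Cat.Hom₂.ext (NatTrans.ext (funext fun A =>
    ((Category.id_comp _).trans (Category.comp_id _)).symm))
  map₂_associator f g h := Cat.Hom₂.ext (NatTrans.ext (funext fun A => by
    change 𝟙 _ = 𝟙 _ ≫ h.F.map (𝟙 _) ≫ 𝟙 _ ≫ 𝟙 _ ≫ 𝟙 _
    simp))
  map₂_left_unitor f := Cat.Hom₂.ext (NatTrans.ext (funext fun A =>
    ((Category.id_comp _).trans ((Category.comp_id _).trans (f.F.map_id _))).symm))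
  map₂_right_unitor f := Cat.Hom₂.ext (NatTrans.ext (funext fun A => by
    change 𝟙 _ = 𝟙 _ ≫ 𝟙 _ ≫ 𝟙 _
    simp))

end TanCat

/-! ### The pseudofunctor `Ind` on the 2-category of categories -/

/-- The pseudofunctor `Ind` on the 2-category of categories, with compositor `φ`. -/
def indCat : Pseudofunctor Cat.{v, max u (v + 1)} Cat.{v, max u (v + 1)} where
  obj C := Cat.of (IndObj.{v, max u (v + 1)} C)
  map F := (indFunctor F.toFunctor).toCatHom
  map₂ r := (indNatTrans r.toNatTrans).toCatHom₂
  mapId C := Cat.Hom.isoMk (indId C)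
  mapComp F G := Cat.Hom.isoMk (indComp F.toFunctor G.toFunctor).symm
  map₂_id F := congrArg NatTrans.toCatHom₂ (indNatTrans_id F.toFunctor)
  map₂_comp r s := congrArg NatTrans.toCatHom₂ (indNatTrans_comp r.toNatTrans s.toNatTrans)
  map₂_whisker_left {C _ _} F G H r := Cat.Hom₂.ext (NatTrans.ext (funext fun (X : IndObj.{v, max u (v + 1)} C) =>
    IndObj.Hom.ext (funext fun i =>
      congrArg (IndObj.germ (⟨X.I, X.F ⋙ F.toFunctor ⋙ H.toFunctor⟩ : IndObj _) i)
        ((Category.id_comp _).trans (Category.comp_id _)).symm)))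
  map₂_whisker_right {C _ _ F G} r H := Cat.Hom₂.ext (NatTrans.ext (funext fun (X : IndObj.{v, max u (v + 1)} C) =>
    IndObj.Hom.ext (funext fun i =>
      congrArg (IndObj.germ (⟨X.I, X.F ⋙ G.toFunctor ⋙ H.toFunctor⟩ : IndObj _) i)
        ((Category.id_comp _).trans (Category.comp_id _)).symm)))
  map₂_associator {C _ _ _} F G H := Cat.Hom₂.ext (NatTrans.ext (funext fun (X : IndObj.{v, max u (v + 1)} C) =>
    IndObj.Hom.ext (funext fun i =>
      congrArg (IndObj.germ
        (⟨X.I, X.F ⋙ F.toFunctor ⋙ G.toFunctor ⋙ H.toFunctor⟩ : IndObj _) i) (by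
        change 𝟙 _ = 𝟙 _ ≫ H.toFunctor.map (𝟙 _) ≫ 𝟙 _ ≫ 𝟙 _ ≫ 𝟙 _
        simp))))
  map₂_left_unitor {C _} F := Cat.Hom₂.ext (NatTrans.ext (funext fun (X : IndObj.{v, max u (v + 1)} C) =>
    IndObj.Hom.ext (funext fun i =>
      congrArg (IndObj.germ (⟨X.I, X.F ⋙ F.toFunctor⟩ : IndObj _) i) (by
        change 𝟙 _ = 𝟙 _ ≫ F.toFunctor.map (𝟙 _) ≫ 𝟙 _
        simp))))
  map₂_right_unitor {C _} F := Cat.Hom₂.ext (NatTrans.ext (funext fun (X : IndObj.{v, max u (v + 1)} C) =>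
    IndObj.Hom.ext (funext fun i =>
      congrArg (IndObj.germ (⟨X.I, X.F ⋙ F.toFunctor⟩ : IndObj _) i) (by
        change 𝟙 _ = 𝟙 _ ≫ 𝟙 _ ≫ 𝟙 _
        simp))))

/-- `(C, 𝕋) ↦ (Ind(C), Ind(𝕋))`, `(F, α) ↦ (Ind(F), α̂)`, `ρ ↦ Ind(ρ)`, as soon as these are
tangent categories, tangent morphisms and tangent transformations. -/
def indTan
    (h₀ : ∀ X : TanCat.{v, max u (v + 1)}, IsTangent X.str.toTangentData.ind)
    (h₁ : ∀ {X Y : TanCat.{v, max u (v + 1)}} (f : X ⟶ Y),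
      IsTangentMorphism (X.str.ind (h₀ X)) (Y.str.ind (h₀ Y)) (indFunctor (TanCat.Hom.F f))
        (indHat (TanCat.Hom.α f)))
    (h₂ : ∀ {X Y : TanCat.{v, max u (v + 1)}} {f g : X ⟶ Y} (r : f ⟶ g),
      IsTangentTransformation (X.str.ind (h₀ X)) (Y.str.ind (h₀ Y)) (indHat (TanCat.Hom.α f))
        (indHat (TanCat.Hom.α g)) (indNatTrans (TanCat.Hom₂.ρ r))) :
    PrelaxFunctorStruct TanCat.{v, max u (v + 1)} TanCat.{v, max u (v + 1)} where
  obj X := { carrier := IndObj.{v, max u (v + 1)} X.carrier, str := X.str.ind (h₀ X) }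
  map f :=
    { F := indFunctor (TanCat.Hom.F f)
      α := indHat (TanCat.Hom.α f)
      isTangentMorphism := h₁ f }
  map₂ r :=
    { ρ := indNatTrans (TanCat.Hom₂.ρ r)
      isTangentTransformation := h₂ r }

end IndTan

open IndTan

namespace IndTan

/-! ### Finite limits in ind-categories -/

section Limits

variable {C : Type u₁} [Category.{v} C] {D : Type u₂} [Category.{v} D]

namespace IndObj

/-! All structure maps of `Ind(𝕋)` are levelwise: at `(X_i)` they are represented by the structure
maps of `𝕋` at the `X_i`, up to identities coming from `φ` and `Ind(id) ≅ id`. Hence an axiom that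
is an equation between composites of structure maps holds in `Ind(C)` because it holds at every
`X_i`. The same applies to tangent morphisms and tangent transformations. What remains are the
limits and the pairings into them.

For the limits, `Y ↦ colim_j C(-, Y_j)` embeds `Ind(C)` fully faithfully into presheaves, and
filtered colimits of sets commute with finite limits. So a finite diagram of systems over one
filtered `I` that has a limit at each level has the levelwise limit as its limit in `Ind(C)`
(`preservesLimit_ofSystem`), and `Ind(F)` preserves it if `F` does so at each level
(`preservesLimit_indFunctor`). The pullback powers and the vertical lift equalizers of `(X_i)` are
of this kind, since all objects involved are indexed by the `I` of `(X_i)`.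

A pairing in `Ind(C)` is given by a universal property, but it can be computed by pairing
representatives once these agree over the base on the nose (`ind_pair_val`). For arbitrary morphisms
into `Ind(T)(X)`, as in associativity, such representatives exist after passing to a later index
(`exists_germ_ind`).

That strength of `(F, α)` gives strength of `(Ind(F), α̂)` is again levelwise. Conversely, constant
ind-objects embed `C` fully faithfully into `Ind(C)`; this embedding preserves the finite limits
that exist in `C`, and `Ind(F)` restricts to `F` along it. Invertibility and preservation of limits
therefore descend from `Ind(F)` to `F`.

For the pseudofunctor, a tangent transformation is a natural transformation with a property. Once
the constraints of `Ind` on `Cat` are known to be tangent transformations, all coherence laws are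
inherited from `indCat`, and compatibility with the forgetful functors is an equality of identical
components. -/

theorem germ_eq_iff (Y : IndObj C) {A : C} {j : Y.I} (φ ψ : A ⟶ Y.F.obj j) :
    Y.germ j φ = Y.germ j ψ ↔ ∃ (k : Y.I) (g : j ⟶ k), φ ≫ Y.F.map g = ψ ≫ Y.F.map g :=
  (Y.F ⋙ coyoneda.obj (op A)).ιColimitType_eq_iff_of_isFiltered' φ ψ

theorem Hom.act_comp {X Y Z : IndObj C} (f : X ⟶ Y) (g : Y ⟶ Z) {A : C} (x : X.Germ A) :
    Hom.act (f ≫ g) x = Hom.act g (Hom.act f x) := by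
  obtain ⟨j, φ, rfl⟩ := X.exists_germ x
  exact (Hom.act_precomp g φ (Hom.val f j)).symm

theorem Hom.act_id {X : IndObj C} {A : C} (x : X.Germ A) : Hom.act (𝟙 X) x = x := by
  obtain ⟨j, φ, rfl⟩ := X.exists_germ x
  exact congrArg (X.germ j) (Category.comp_id φ)

/-- The functor that sends an ind-object to the presheaf `A ↦ colim_j C(A, Y_j)`. -/
def germFunctor (C : Type u₁) [Category.{v} C] : IndObj C ⥤ Cᵒᵖ ⥤ Type v where
  obj Y :=
    { obj := fun A => Y.Germ A.unop
      map := fun a => TypeCat.ofHom (Germ.precomp a.unop)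
      map_id := fun A => by ext x; exact Germ.precomp_id x
      map_comp := fun a b => by ext x; exact (Germ.precomp_precomp a.unop b.unop x).symm }
  map g :=
    { app := fun A => TypeCat.ofHom (Hom.act g)
      naturality := fun A B a => by ext x; exact Hom.act_precomp g a.unop x }
  map_id Y := by ext A x; exact Hom.act_id x
  map_comp f g := by ext A x; exact Hom.act_comp f g x

/-- An ind-object is determined by its presheaf of germs. -/
def fullyFaithfulGermFunctor (C : Type u₁) [Category.{v} C] : (germFunctor C).FullyFaithful where
  preimage {X Y} η :=
    -- As in the Yoneda lemma, `η` is determined by its values on the classes of the identities of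
    -- the `X_i`.
    { val := fun i => η.app (op (X.F.obj i)) (X.germ i (𝟙 _))
      compat := fun {i i'} f => by
        have h := ConcreteCategory.congr_hom (η.naturality (X.F.map f).op) (X.germ i' (𝟙 _))
        refine h.symm.trans (congrArg (η.app (op (X.F.obj i))) ?_)
        refine Eq.trans (congrArg (X.germ i') ?_) (X.germ_map f (𝟙 _))
        exact (Category.comp_id _).trans (Category.id_comp _).symm }
  map_preimage {X Y} η := by
    ext A x
    obtain ⟨j, φ, rfl⟩ := X.exists_germ x
    have h := ConcreteCategory.congr_hom (η.naturality φ.op) (X.germ j (𝟙 _))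
    refine h.symm.trans (congrArg (η.app A) ?_)
    exact congrArg (X.germ j) (Category.comp_id _)
  preimage_map {X Y} f := Hom.ext (funext fun i => Germ.precomp_id (Hom.val f i))

instance : (germFunctor C).Full := (fullyFaithfulGermFunctor C).full

instance : (germFunctor C).Faithful := (fullyFaithfulGermFunctor C).faithful

/-- The functor that regards a filtered system as an ind-object. -/
def ofSystem (I : Type v) [SmallCategory I] [IsFiltered I] (C : Type u₁) [Category.{v} C] :
    (I ⥤ C) ⥤ IndObj C where
  obj X := ⟨I, X⟩
  map η := homOfNatTrans η
  map_id _ := rfl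
  map_comp _ _ := rfl

/-- The ind-object given by a single object. -/
def const (C : Type u₁) [Category.{v} C] : C ⥤ IndObj C :=
  Functor.const (Discrete PUnit.{v + 1}) ⋙ ofSystem _ C

section

variable (I : Type v) [SmallCategory I] [IsFiltered I]

/-- The presheaf of germs of a filtered system, computed as a colimit of sets. -/
noncomputable def ofSystemGermIso (A : C) :
    ofSystem I C ⋙ germFunctor C ⋙ (evaluation Cᵒᵖ (Type v)).obj (op A) ≅
      (Functor.whiskeringRight I C (Type v)).obj (coyoneda.obj (op A)) ⋙ colim :=
  NatIso.ofComponents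
    (fun X => (Types.colimitEquivColimitType (X ⋙ coyoneda.obj (op A))).symm.toIso)
    (fun {X Y} η => by
      ext x
      obtain ⟨j, φ, rfl⟩ := exists_germ ⟨I, X⟩ x
      have h := ConcreteCategory.congr_hom (ι_colimMap (Functor.whiskerRight η (coyoneda.obj (op A))) j) φ
      refine Eq.trans ?_ (Eq.trans h.symm ?_)
      · exact Types.colimitEquivColimitType_symm_apply (Y ⋙ coyoneda.obj (op A)) j (φ ≫ η.app j)
      · exact congrArg (colimMap (Functor.whiskerRight η (coyoneda.obj (op A))))
          (Types.colimitEquivColimitType_symm_apply (X ⋙ coyoneda.obj (op A)) j φ).symm)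

variable {J : Type} [SmallCategory J] [FinCategory J]

/-- Levelwise finite limits are limits in the ind-category. -/
theorem preservesLimit_ofSystem (K : J ⥤ I ⥤ C)
    [∀ i, HasLimit (K ⋙ (evaluation I C).obj i)] : PreservesLimit K (ofSystem I C) := by
  have : PreservesLimit K (ofSystem I C ⋙ germFunctor C) := by
    refine preservesLimit_of_evaluation _ _ (fun A => ?_)
    have : ∀ k : I, HasLimit (K.flip.obj k) := fun k =>
      inferInstanceAs (HasLimit (K ⋙ (evaluation I C).obj k))
    have : PreservesLimit K ((Functor.whiskeringRight I C (Type v)).obj (coyoneda.obj (op A.unop))) := by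
      refine preservesLimit_of_evaluation _ _ (fun i => ?_)
      exact inferInstanceAs
        (PreservesLimit K ((evaluation I C).obj i ⋙ coyoneda.obj (op A.unop)))
    -- At `A` the germs form the filtered colimit of the sets `C(A, X_i)`, and filtered colimits of
    -- sets commute with finite limits.
    exact preservesLimit_of_natIso K (ofSystemGermIso I A.unop).symm
  -- A fully faithful functor reflects limits.
  exact preservesLimit_of_reflects_of_preserves (ofSystem I C) (germFunctor C)

/-- The index category has a single object, so every germ has a representative there. It has only
identity transitions, so that representative is unique, which gives faithfulness below. -/
instance : (const C).Full where
  map_surjective {X Y} f := by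
    obtain ⟨j, φ, h⟩ := exists_germ ((const C).obj Y) (Hom.val f ⟨PUnit.unit⟩)
    refine ⟨φ, Hom.ext (funext fun i => ?_)⟩
    obtain ⟨⟨⟩⟩ := i
    exact h

instance : (const C).Faithful where
  map_injective {X Y φ ψ} h := by
    obtain ⟨k, g, e⟩ := (germ_eq_iff ((const C).obj Y) φ ψ).1
      (congrFun (congrArg Hom.val h) ⟨PUnit.unit⟩)
    exact (Category.comp_id φ).symm.trans (e.trans (Category.comp_id ψ))

/-- A constant ind-object is a system over the one-object index category, so this is a case of
levelwise limits. It serves to bring statements about limits in `Ind(C)` back to `C`. -/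
theorem preservesLimit_const (K : J ⥤ C) [HasLimit K] : PreservesLimit K (const C) := by
  have : PreservesLimit K (Functor.const (Discrete PUnit.{v + 1}) (C := C)) :=
    preservesLimit_of_evaluation _ _ (fun _ => inferInstanceAs (PreservesLimit K (𝟭 C)))
  have : ∀ i, HasLimit ((K ⋙ Functor.const (Discrete PUnit.{v + 1})) ⋙
      (evaluation (Discrete PUnit.{v + 1}) C).obj i) := fun i => inferInstanceAs (HasLimit K)
  have := preservesLimit_ofSystem _ (K ⋙ Functor.const (Discrete PUnit.{v + 1}))
  exact comp_preservesLimit _ _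

/-- `Ind(F)` preserves the levelwise finite limits that `F` preserves at each level. -/
theorem preservesLimit_indFunctor (K : J ⥤ I ⥤ C) (F : C ⥤ D)
    [∀ i, HasLimit (K ⋙ (evaluation I C).obj i)]
    [∀ i, PreservesLimit (K ⋙ (evaluation I C).obj i) F] :
    PreservesLimit (K ⋙ ofSystem I C) (indFunctor F) := by
  have : ∀ k : I, HasLimit (K.flip.obj k) := fun k =>
    inferInstanceAs (HasLimit (K ⋙ (evaluation I C).obj k))
  have := preservesLimit_ofSystem I K
  have : PreservesLimit K ((Functor.whiskeringRight I C D).obj F) := by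
    refine preservesLimit_of_evaluation _ _ (fun i => ?_)
    exact inferInstanceAs (PreservesLimit K ((evaluation I C).obj i ⋙ F))
  have : ∀ i, HasLimit ((K ⋙ (Functor.whiskeringRight I C D).obj F) ⋙ (evaluation I D).obj i) :=
    fun i => inferInstanceAs (HasLimit ((K ⋙ (evaluation I C).obj i) ⋙ F))
  have := preservesLimit_ofSystem I (K ⋙ (Functor.whiskeringRight I C D).obj F)
  -- The levelwise limit cone stays a limit cone under `ofSystem`. Its image under `Ind(F)` is by
  -- definition the cone obtained by applying `F` levelwise and then `ofSystem`, which is again a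
  -- limit cone.
  exact preservesLimit_of_preserves_limit_cone
    (isLimitOfPreserves (ofSystem I C) (limit.isLimit K))
    (isLimitOfPreserves ((Functor.whiskeringRight I C D).obj F ⋙ ofSystem I D) (limit.isLimit K))

/-- A finite diagram of ind-objects that comes from levelwise diagrams with limits has a limit. -/
theorem hasLimit_of_system {L : J ⥤ IndObj C} (K : J ⥤ I ⥤ C) (e : K ⋙ ofSystem I C ≅ L)
    [∀ i, HasLimit (K ⋙ (evaluation I C).obj i)] : HasLimit L := by
  have : ∀ k : I, HasLimit (K.flip.obj k) := fun k =>
    inferInstanceAs (HasLimit (K ⋙ (evaluation I C).obj k))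
  have := preservesLimit_ofSystem I K
  exact hasLimit_of_iso e

end

end IndObj

end Limits

end IndTan

/-! ### Levelwise pullbacks and equalizers; tangent pullback powers of ind-objects -/

namespace IndTan

namespace IndObj

section

variable {C : Type u₁} [Category.{v} C] (I : Type v) [SmallCategory I] [IsFiltered I]

theorem isPullback_ofSystem {W X Y Z : I ⥤ C} {a : W ⟶ X} {b : W ⟶ Y} {f : X ⟶ Z} {g : Y ⟶ Z}
    (h : ∀ i, IsPullback (a.app i) (b.app i) (f.app i) (g.app i)) :
    IsPullback ((ofSystem I C).map a) ((ofSystem I C).map b) ((ofSystem I C).map f)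
      ((ofSystem I C).map g) := by
  have : ∀ i, HasLimit (cospan f g ⋙ (evaluation I C).obj i) := fun i => by
    have : HasLimit (cospan (((evaluation I C).obj i).map f) (((evaluation I C).obj i).map g)) :=
      (h i).hasPullback
    exact hasLimit_of_iso (cospanCompIso ((evaluation I C).obj i) f g).symm
  have := preservesLimit_ofSystem I (cospan f g)
  exact (IsPullback.of_forall_isPullback_app h).map (ofSystem I C)

omit [IsFiltered I] in
theorem hasLimit_parallelPair_comp_evaluation {X Y : I ⥤ C} (f g : X ⟶ Y) (i : I)
    [HasLimit (parallelPair (f.app i) (g.app i))] :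
    HasLimit (parallelPair f g ⋙ (evaluation I C).obj i) :=
  hasLimit_of_iso (G := parallelPair f g ⋙ (evaluation I C).obj i)
    (F := parallelPair (f.app i) (g.app i))
    (diagramIsoParallelPair (parallelPair f g ⋙ (evaluation I C).obj i)).symm

theorem isLimit_fork_ofSystem {W X Y : I ⥤ C} {h : W ⟶ X} {f g : X ⟶ Y} (w : h ≫ f = h ≫ g)
    (hl : ∀ i, Nonempty (IsLimit (Fork.ofι (h.app i) (NatTrans.congr_app w i)))) :
    Nonempty (IsLimit (Fork.ofι (f := (ofSystem I C).map f) (g := (ofSystem I C).map g)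
      ((ofSystem I C).map h) (by rw [← Functor.map_comp, w, Functor.map_comp]))) := by
  have : ∀ i, HasLimit (parallelPair f g ⋙ (evaluation I C).obj i) := fun i => by
    have : HasLimit (parallelPair (f.app i) (g.app i)) := ⟨⟨_, (hl i).some⟩⟩
    exact hasLimit_parallelPair_comp_evaluation I f g i
  have := preservesLimit_ofSystem I (parallelPair f g)
  -- Limit cones in `I ⥤ C` are detected at each level.
  exact ⟨isLimitForkMapOfIsLimit (ofSystem I C) w (evaluationJointlyReflectsLimits _
    (fun i => (isLimitMapConeForkEquiv ((evaluation I C).obj i) w).symm (hl i).some))⟩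

end

section

variable {C : Type u₁} [Category.{v} C]

/-- Filteredness moves two representatives to a common index. -/
theorem exists_germ₂ (Y : IndObj C) {A : C} (x y : Y.Germ A) :
    ∃ (j : Y.I) (φ ψ : A ⟶ Y.F.obj j), x = Y.germ j φ ∧ y = Y.germ j ψ := by
  obtain ⟨j, φ, rfl⟩ := Y.exists_germ x
  obtain ⟨k, ψ, rfl⟩ := Y.exists_germ y
  exact ⟨_, _, _, (Y.germ_map (IsFiltered.leftToMax j k) φ).symm,
    (Y.germ_map (IsFiltered.rightToMax j k) ψ).symm⟩

theorem exists_germ₃ (Y : IndObj C) {A : C} (x y z : Y.Germ A) :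
    ∃ (j : Y.I) (φ ψ χ : A ⟶ Y.F.obj j),
      x = Y.germ j φ ∧ y = Y.germ j ψ ∧ z = Y.germ j χ := by
  obtain ⟨j, φ, ψ, rfl, rfl⟩ := Y.exists_germ₂ x y
  obtain ⟨k, χ, rfl⟩ := Y.exists_germ z
  exact ⟨_, _, _, _, (Y.germ_map (IsFiltered.leftToMax j k) φ).symm,
    (Y.germ_map (IsFiltered.leftToMax j k) ψ).symm,
    (Y.germ_map (IsFiltered.rightToMax j k) χ).symm⟩

end

end IndObj

open IndObj

section TangentPullbacks

variable {C : Type u₁} [Category.{v} C] {D : Type u₂} [Category.{v} D]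

/-- `Ind` commutes with iteration of endofunctors. -/
def indIter (T : C ⥤ C) : ∀ m : ℕ, iter (indFunctor T) m ≅ indFunctor (iter T m)
  | 0 => (indId C).symm
  | m + 1 => Functor.isoWhiskerRight (indIter T m) (indFunctor T) ≪≫ indComp (iter T m) T

/-- A functor sends a wide cospan to a wide cospan. -/
def wideCospanCompIso {n : ℕ} (G : C ⥤ D) (B : C) (objs : Fin n → C) (arrows : ∀ j, objs j ⟶ B) :
    WidePullbackShape.wideCospan B objs arrows ⋙ G ≅
      WidePullbackShape.wideCospan (G.obj B) (fun j => G.obj (objs j))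
        (fun j => G.map (arrows j)) :=
  WidePullbackShape.diagramIsoWideCospan _

variable (t : TangentData C)

namespace TangentData

/-- The isomorphism `Ind(id) ≅ id` contributes only an identity at each level. Rewriting with this
and the next three lemmas turns the equations among structure maps into equations of levelwise maps,
to be checked on the representative at each index. -/
theorem ind_p_app (X : IndObj C) :
    t.ind.p.app X = (ofSystem X.I C).map (Functor.whiskerLeft X.F t.p) :=
  IndObj.Hom.ext (funext fun i => congrArg (X.germ i) (Category.comp_id (t.p.app (X.F.obj i))))

theorem ind_zero_app (X : IndObj C) :
    t.ind.zero.app X = (ofSystem X.I C).map (Functor.whiskerLeft X.F t.zero) :=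
  IndObj.Hom.ext (funext fun i => congrArg (germ ((indFunctor t.T).obj X) i)
    (Category.id_comp (t.zero.app (X.F.obj i))))

theorem ind_ℓ_app (X : IndObj C) :
    t.ind.ℓ.app X = (ofSystem X.I C).map (Functor.whiskerLeft X.F t.ℓ) :=
  IndObj.Hom.ext (funext fun i => congrArg (germ ((indFunctor (t.T ⋙ t.T)).obj X) i)
    (Category.comp_id (t.ℓ.app (X.F.obj i))))

theorem ind_c_app (X : IndObj C) :
    t.ind.c.app X = (ofSystem X.I C).map (Functor.whiskerLeft X.F t.c) :=
  IndObj.Hom.ext (funext fun i => congrArg (germ ((indFunctor (t.T ⋙ t.T)).obj X) i)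
    ((Category.id_comp _).trans (Category.comp_id (t.c.app (X.F.obj i)))))

/-- The levelwise pullback diagrams of an ind-object. -/
abbrev powerSystem (n : ℕ) (X : IndObj C) : WidePullbackShape (Fin n) ⥤ X.I ⥤ C :=
  WidePullbackShape.wideCospan X.F (fun _ => X.F ⋙ t.T) (fun _ => Functor.whiskerLeft X.F t.p)

/-- The pullback diagram of an ind-object is given by the levelwise ones. -/
def powerSystemIso (n : ℕ) (X : IndObj C) :
    t.powerSystem n X ⋙ ofSystem X.I C ≅ t.ind.powerDiagram n X :=
  wideCospanCompIso (ofSystem X.I C) X.F (fun _ => X.F ⋙ t.T)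
    (fun _ => Functor.whiskerLeft X.F t.p) ≪≫
  -- The arrows of the two cospans are only propositionally equal, by `ind_p_app`.
  eqToIso (congrArg (fun a => WidePullbackShape.wideCospan X
    (fun _ : Fin n => (indFunctor t.T).obj X) (fun _ => a)) (t.ind_p_app X).symm)

/-- The levelwise pullback diagrams at one level. -/
def powerSystemEvaluationIso (n : ℕ) (X : IndObj C) (i : X.I) :
    t.powerSystem n X ⋙ (evaluation X.I C).obj i ≅ t.powerDiagram n (X.F.obj i) :=
  wideCospanCompIso ((evaluation X.I C).obj i) X.F (fun _ => X.F ⋙ t.T)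
    (fun _ => Functor.whiskerLeft X.F t.p)

theorem hasLimit_powerSystem (h : HasTangentPullbacks t) (n : ℕ) (X : IndObj C) (i : X.I) :
    HasLimit (t.powerSystem n X ⋙ (evaluation X.I C).obj i) :=
  have := h.hasLimit_power n (X.F.obj i)
  hasLimit_of_iso (t.powerSystemEvaluationIso n X i).symm

/-- The functor is arbitrary because two cases are needed: the iterates of `T` in the tangent axioms
and the underlying functor of a strong morphism. -/
theorem preservesLimit_ind_powerDiagram (h : HasTangentPullbacks t) (F : C ⥤ D) (n : ℕ)
    (hF : ∀ A, PreservesLimit (t.powerDiagram n A) F) (X : IndObj C) :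
    PreservesLimit (t.ind.powerDiagram n X) (indFunctor F) := by
  have := t.hasLimit_powerSystem h n X
  have : ∀ i, PreservesLimit (t.powerSystem n X ⋙ (evaluation X.I C).obj i) F := fun i =>
    preservesLimit_of_iso_diagram F (t.powerSystemEvaluationIso n X i).symm
  have := preservesLimit_indFunctor X.I (t.powerSystem n X) F
  exact preservesLimit_of_iso_diagram (indFunctor F) (t.powerSystemIso n X)

theorem ind_hasTangentPullbacks (h : HasTangentPullbacks t) : HasTangentPullbacks t.ind where
  isPullback X := by
    rw [ind_p_app]
    exact isPullback_ofSystem X.I (a := Functor.whiskerLeft X.F t.π₁)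
      (b := Functor.whiskerLeft X.F t.π₂) (fun i => h.isPullback (X.F.obj i))
  hasLimit_power n X := by
    have := t.hasLimit_powerSystem h n X
    exact hasLimit_of_system X.I (t.powerSystem n X) (t.powerSystemIso n X)
  preserves_power m n X := by
    have := t.preservesLimit_ind_powerDiagram h (iter t.T m) n (h.preserves_power m n) X
    exact preservesLimit_of_natIso _ (indIter t.T m).symm

end TangentData

namespace HasTangentPullbacks

variable {t}

/-- The two projections become equal at possibly different indices `k` and `l`. Over a common later
index both agree, and the projections of `T₂` are jointly monic there. -/
theorem exists_map_eq_of_system (h : HasTangentPullbacks t) {I : Type v} [SmallCategory I]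
    [IsFiltered I] (X : I ⥤ C) {A : C} {j k l : I} {φ ψ : A ⟶ t.T₂.obj (X.obj j)} (f : j ⟶ k)
    (hf : (φ ≫ t.π₁.app (X.obj j)) ≫ t.T.map (X.map f) =
      (ψ ≫ t.π₁.app (X.obj j)) ≫ t.T.map (X.map f)) (g : j ⟶ l)
    (hg : (φ ≫ t.π₂.app (X.obj j)) ≫ t.T.map (X.map g) =
      (ψ ≫ t.π₂.app (X.obj j)) ≫ t.T.map (X.map g)) :
    ∃ (m : I) (a : j ⟶ m), φ ≫ t.T₂.map (X.map a) = ψ ≫ t.T₂.map (X.map a) := by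
  obtain ⟨m, a, b, e⟩ := IsFiltered.span f g
  refine ⟨m, f ≫ a, h.hom_ext ?_ ?_⟩
  · simpa using congrArg (· ≫ t.T.map (X.map a)) hf
  · rw [e]
    simpa using congrArg (· ≫ t.T.map (X.map b)) hg

/-- The projections of `Ind(T₂)` are jointly injective on germs. This identifies a pairing in
`Ind(C)` with the class of a pairing of representatives. -/
theorem ind_germ_ext (h : HasTangentPullbacks t) {X : IndObj C} {A : C}
    {x y : ((indFunctor t.T₂).obj X).Germ A}
    (h₁ : Hom.act (t.ind.π₁.app X) x = Hom.act (t.ind.π₁.app X) y)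
    (h₂ : Hom.act (t.ind.π₂.app X) x = Hom.act (t.ind.π₂.app X) y) : x = y := by
  obtain ⟨j, φ, ψ, rfl, rfl⟩ := exists_germ₂ _ x y
  obtain ⟨k, f, hf⟩ := (germ_eq_iff ((indFunctor t.T).obj X) (φ ≫ t.π₁.app _)
    (ψ ≫ t.π₁.app _)).1 h₁
  obtain ⟨l, g, hg⟩ := (germ_eq_iff ((indFunctor t.T).obj X) (φ ≫ t.π₂.app _)
    (ψ ≫ t.π₂.app _)).1 h₂
  exact (germ_eq_iff _ φ ψ).2 (h.exists_map_eq_of_system X.F f hf g hg)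

/-- The pairing of morphisms of ind-objects is computed on representatives. -/
theorem ind_pair_val (h : HasTangentPullbacks t) (h' : HasTangentPullbacks t.ind) {X Z : IndObj C}
    {x y : Z ⟶ t.ind.T.obj X} (e : x ≫ t.ind.p.app X = y ≫ t.ind.p.app X) {i : Z.I} {j : X.I}
    {φ ψ : Z.F.obj i ⟶ t.T.obj (X.F.obj j)}
    (hx : Hom.val x i = germ ((indFunctor t.T).obj X) j φ)
    (hy : Hom.val y i = germ ((indFunctor t.T).obj X) j ψ)
    (e' : φ ≫ t.p.app (X.F.obj j) = ψ ≫ t.p.app (X.F.obj j)) :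
    Hom.val (h'.pair x y e) i = germ ((indFunctor t.T₂).obj X) j (h.pair φ ψ e') := by
  refine h.ind_germ_ext ?_ ?_
  · refine (congrFun (congrArg Hom.val (h'.pair_π₁ x y e)) i).trans (hx.trans ?_)
    exact congrArg (germ ((indFunctor t.T).obj X) j) (h.pair_π₁ φ ψ e').symm
  · refine (congrFun (congrArg Hom.val (h'.pair_π₂ x y e)) i).trans (hy.trans ?_)
    exact congrArg (germ ((indFunctor t.T).obj X) j) (h.pair_π₂ φ ψ e').symm

/-- The sum of morphisms of ind-objects is computed on representatives. -/
theorem ind_pair_add_val (h : HasTangentPullbacks t) (h' : HasTangentPullbacks t.ind)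
    {X Z : IndObj C} {x y : Z ⟶ t.ind.T.obj X} (e : x ≫ t.ind.p.app X = y ≫ t.ind.p.app X)
    {i : Z.I} {j : X.I} {φ ψ : Z.F.obj i ⟶ t.T.obj (X.F.obj j)}
    (hx : Hom.val x i = germ ((indFunctor t.T).obj X) j φ)
    (hy : Hom.val y i = germ ((indFunctor t.T).obj X) j ψ)
    (e' : φ ≫ t.p.app (X.F.obj j) = ψ ≫ t.p.app (X.F.obj j)) :
    Hom.val (h'.pair x y e ≫ t.ind.add.app X) i =
      germ ((indFunctor t.T).obj X) j (h.pair φ ψ e' ≫ t.add.app (X.F.obj j)) :=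
  congrArg (Hom.act (t.ind.add.app X)) (h.ind_pair_val h' e hx hy e')

end HasTangentPullbacks

end TangentPullbacks

end IndTan

/-! ### The tangent axioms for the ind-tangent structure -/

namespace IndTan

open IndObj

section IndTangent

variable {C : Type u₁} [Category.{v} C] {D : Type u₂} [Category.{v} D]

namespace IsTangent

variable {t : TangentData C} (h : IsTangent t)

include h

/-- This and the next three lemmas name the side conditions that the axioms of `IsTangent` establish
inline, so that pairings of representatives can be formed. -/
theorem zero_add_condition (X : C) :
    (t.p.app X ≫ t.zero.app X) ≫ t.p.app X = 𝟙 (t.T.obj X) ≫ t.p.app X := by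
  rw [Category.assoc, h.zero_p, Category.id_comp]
  exact Category.comp_id _

theorem c_add_condition (X : C) :
    (t.T.map (t.π₁.app X) ≫ t.c.app X) ≫ t.p.app (t.T.obj X) =
      (t.T.map (t.π₂.app X) ≫ t.c.app X) ≫ t.p.app (t.T.obj X) := by
  rw [Category.assoc, Category.assoc, h.c_p, ← t.T.map_comp, ← t.T.map_comp, (h.isPullback X).w]

theorem ℓ_add_condition (X : C) :
    (t.π₁.app X ≫ t.ℓ.app X) ≫ t.p.app (t.T.obj X) =
      (t.π₂.app X ≫ t.ℓ.app X) ≫ t.p.app (t.T.obj X) := by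
  have e : t.ℓ.app X ≫ t.p.app (t.T.obj X) = t.p.app X ≫ t.zero.app X := by
    rw [← h.ℓ_p, ← h.c_p, ← Category.assoc, h.ℓ_c]
  rw [Category.assoc, Category.assoc, e, ← Category.assoc, ← Category.assoc, (h.isPullback X).w]

theorem verticalLift_condition (X : C) :
    (t.π₁.app X ≫ t.ℓ.app X) ≫ t.T.map (t.p.app X) =
      (t.π₂.app X ≫ t.zero.app (t.T.obj X)) ≫ t.T.map (t.p.app X) := by
  have e : t.zero.app (t.T.obj X) ≫ t.T.map (t.p.app X) = t.p.app X ≫ t.zero.app X :=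
    (t.zero.naturality (t.p.app X)).symm
  rw [Category.assoc, Category.assoc, e, h.ℓ_p, ← Category.assoc, ← Category.assoc,
    (h.isPullback X).w]

/-- The pairing `⟨ℓ ∘ π₁, 0_T ∘ π₂⟩ : T₂ ⟶ T T₂` as a natural transformation. -/
noncomputable def liftPair : t.T₂ ⟶ t.T₂ ⋙ t.T where
  app X := h.mapPair (X := X) (t.π₁.app X ≫ t.ℓ.app X) (t.π₂.app X ≫ t.zero.app (t.T.obj X))
    (h.verticalLift_condition X)
  naturality X Y f := by
    have hℓ : t.T.map f ≫ t.ℓ.app Y = t.ℓ.app X ≫ t.T.map (t.T.map f) := t.ℓ.naturality f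
    have hz : t.T.map f ≫ t.zero.app (t.T.obj Y) = t.zero.app (t.T.obj X) ≫ t.T.map (t.T.map f) :=
      t.zero.naturality (t.T.map f)
    unfold HasTangentPullbacks.mapPair
    refine (h.map_isPullback Y).hom_ext ?_ ?_
    · rw [Category.assoc, IsPullback.lift_fst, Category.assoc, Functor.comp_map, ← t.T.map_comp,
        t.π₁.naturality, t.T.map_comp, IsPullback.lift_fst_assoc, ← Category.assoc,
        t.π₁.naturality, Category.assoc, hℓ, Category.assoc]
    · rw [Category.assoc, IsPullback.lift_snd, Category.assoc, Functor.comp_map, ← t.T.map_comp,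
        t.π₂.naturality, t.T.map_comp, IsPullback.lift_snd_assoc, ← Category.assoc,
        t.π₂.naturality, Category.assoc, hz, Category.assoc]

/-- The universal map `T(+) ∘ ⟨ℓ ∘ π₁, 0_T ∘ π₂⟩ : T₂ ⟶ T²` as a natural transformation. -/
noncomputable def verticalLift : t.T₂ ⟶ t.T ⋙ t.T :=
  h.liftPair ≫ Functor.whiskerRight t.add t.T

end IsTangent

namespace TangentData

variable {t : TangentData C}

/-- Equality of germs over the base becomes equality of morphisms at a later index. A span out of
`j` is completed to a square to get both equalities at one index, and naturality of `p` moves them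
to the transported representatives. -/
theorem exists_map_eq_of_system {I : Type v} [SmallCategory I] [IsFiltered I] (X : I ⥤ C) {A : C}
    {j k l : I} {φ ψ χ : A ⟶ t.T.obj (X.obj j)} (f : j ⟶ k)
    (hf : (φ ≫ t.p.app (X.obj j)) ≫ X.map f = (ψ ≫ t.p.app (X.obj j)) ≫ X.map f) (g : j ⟶ l)
    (hg : (ψ ≫ t.p.app (X.obj j)) ≫ X.map g = (χ ≫ t.p.app (X.obj j)) ≫ X.map g) :
    ∃ (m : I) (a : j ⟶ m),
      (φ ≫ t.T.map (X.map a)) ≫ t.p.app (X.obj m) = (ψ ≫ t.T.map (X.map a)) ≫ t.p.app (X.obj m) ∧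
      (ψ ≫ t.T.map (X.map a)) ≫ t.p.app (X.obj m) =
        (χ ≫ t.T.map (X.map a)) ≫ t.p.app (X.obj m) := by
  obtain ⟨m, a, b, e⟩ := IsFiltered.span f g
  refine ⟨m, f ≫ a, ?_, ?_⟩
  · simpa using congrArg (· ≫ X.map a) hf
  · rw [e]
    simpa using congrArg (· ≫ X.map b) hg

/-- Three germs over the same germ have representatives over the same morphism. -/
theorem exists_germ_ind (t : TangentData C) {X : IndObj C} {A : C}
    {x y z : ((indFunctor t.T).obj X).Germ A}
    (hxy : IndObj.Hom.act (t.ind.p.app X) x = IndObj.Hom.act (t.ind.p.app X) y)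
    (hyz : IndObj.Hom.act (t.ind.p.app X) y = IndObj.Hom.act (t.ind.p.app X) z) :
    ∃ (j : X.I) (φ ψ χ : A ⟶ t.T.obj (X.F.obj j)),
      x = germ ((indFunctor t.T).obj X) j φ ∧ y = germ ((indFunctor t.T).obj X) j ψ ∧
      z = germ ((indFunctor t.T).obj X) j χ ∧
      φ ≫ t.p.app (X.F.obj j) = ψ ≫ t.p.app (X.F.obj j) ∧
      ψ ≫ t.p.app (X.F.obj j) = χ ≫ t.p.app (X.F.obj j) := by
  obtain ⟨j, φ, ψ, χ, rfl, rfl, rfl⟩ := exists_germ₃ _ x y z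
  rw [ind_p_app] at hxy hyz
  obtain ⟨k, f, hf⟩ := (germ_eq_iff X (φ ≫ t.p.app _) (ψ ≫ t.p.app _)).1 hxy
  obtain ⟨l, g, hg⟩ := (germ_eq_iff X (ψ ≫ t.p.app _) (χ ≫ t.p.app _)).1 hyz
  obtain ⟨m, a, h₁, h₂⟩ := exists_map_eq_of_system X.F f hf g hg
  exact ⟨m, _, _, _, (germ_map ((indFunctor t.T).obj X) a φ).symm,
    (germ_map ((indFunctor t.T).obj X) a ψ).symm,
    (germ_map ((indFunctor t.T).obj X) a χ).symm, h₁, h₂⟩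

variable (h : IsTangent t)

include h

theorem ind_zero_p (X : IndObj C) : t.ind.zero.app X ≫ t.ind.p.app X = 𝟙 X := by
  rw [ind_zero_app, ind_p_app]
  exact IndObj.Hom.ext (funext fun i => congrArg (germ X i) (h.zero_p _))

theorem ind_add_p (X : IndObj C) :
    t.ind.add.app X ≫ t.ind.p.app X = t.ind.π₁.app X ≫ t.ind.p.app X := by
  rw [ind_p_app]
  exact IndObj.Hom.ext (funext fun i => congrArg (germ X i) (h.add_p _))

/-- The pullback property `h'` and the side condition `e` are arbitrary here and below, so that the
result applies to whichever proofs occur in the fields of `IsTangent`. -/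
theorem ind_zero_add (X : IndObj C) (h' : HasTangentPullbacks t.ind)
    (e : (t.ind.p.app X ≫ t.ind.zero.app X) ≫ t.ind.p.app X =
      𝟙 (t.ind.T.obj X) ≫ t.ind.p.app X) :
    h'.pair (t.ind.p.app X ≫ t.ind.zero.app X) (𝟙 (t.ind.T.obj X)) e ≫ t.ind.add.app X =
      𝟙 (t.ind.T.obj X) :=
  IndObj.Hom.ext (funext fun i => by
    refine (h.ind_pair_add_val h' e (j := i)
      (φ := t.p.app (X.F.obj i) ≫ t.zero.app (X.F.obj i)) (ψ := 𝟙 _) ?_ rfl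
      (h.zero_add_condition _)).trans ?_
    · rw [ind_p_app, ind_zero_app]
      rfl
    · exact congrArg (germ ((indFunctor t.T).obj X) i) (h.zero_add _))

theorem ind_add_comm (X : IndObj C) (h' : HasTangentPullbacks t.ind)
    (e : t.ind.π₂.app X ≫ t.ind.p.app X = t.ind.π₁.app X ≫ t.ind.p.app X) :
    h'.pair (t.ind.π₂.app X) (t.ind.π₁.app X) e ≫ t.ind.add.app X = t.ind.add.app X :=
  IndObj.Hom.ext (funext fun i => by
    refine (h.ind_pair_add_val h' e (j := i) rfl rfl (h.isPullback _).w.symm).trans ?_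
    exact congrArg (germ ((indFunctor t.T).obj X) i) (h.add_comm _))

/-- The elements `x`, `y`, `z` need not be levelwise. At each index of `Z` they have representatives
at one index of `X` that agree over the base, and associativity in `C` applies to these. -/
theorem ind_add_assoc {X Z : IndObj C} (h' : HasTangentPullbacks t.ind)
    (x y z : Z ⟶ t.ind.T.obj X)
    (hxy : x ≫ t.ind.p.app X = y ≫ t.ind.p.app X) (hyz : y ≫ t.ind.p.app X = z ≫ t.ind.p.app X)
    (e₁ : (h'.pair x y hxy ≫ t.ind.add.app X) ≫ t.ind.p.app X = z ≫ t.ind.p.app X)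
    (e₂ : x ≫ t.ind.p.app X = (h'.pair y z hyz ≫ t.ind.add.app X) ≫ t.ind.p.app X) :
    h'.pair (h'.pair x y hxy ≫ t.ind.add.app X) z e₁ ≫ t.ind.add.app X =
      h'.pair x (h'.pair y z hyz ≫ t.ind.add.app X) e₂ ≫ t.ind.add.app X :=
  IndObj.Hom.ext (funext fun i => by
    obtain ⟨j, φ, ψ, χ, hx, hy, hz, pxy, pyz⟩ := t.exists_germ_ind
      (congrFun (congrArg IndObj.Hom.val hxy) i) (congrFun (congrArg IndObj.Hom.val hyz) i)
    have p₁ : (h.pair φ ψ pxy ≫ t.add.app (X.F.obj j)) ≫ t.p.app (X.F.obj j) =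
        χ ≫ t.p.app (X.F.obj j) := by
      rw [Category.assoc, h.add_p, ← Category.assoc, h.pair_π₁, pxy, pyz]
    have p₂ : φ ≫ t.p.app (X.F.obj j) =
        (h.pair ψ χ pyz ≫ t.add.app (X.F.obj j)) ≫ t.p.app (X.F.obj j) := by
      rw [Category.assoc, h.add_p, ← Category.assoc, h.pair_π₁, pxy]
    refine (h.ind_pair_add_val h' e₁ (h.ind_pair_add_val h' hxy hx hy pxy) hz p₁).trans
      (Eq.trans ?_ (h.ind_pair_add_val h' e₂ hx (h.ind_pair_add_val h' hyz hy hz pyz) p₂).symm)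
    exact congrArg (germ ((indFunctor t.T).obj X) j) (h.add_assoc φ ψ χ pxy pyz))

theorem ind_c_p (X : IndObj C) :
    t.ind.c.app X ≫ t.ind.p.app (t.ind.T.obj X) = t.ind.T.map (t.ind.p.app X) := by
  rw [ind_c_app, ind_p_app, ind_p_app]
  exact IndObj.Hom.ext (funext fun i => congrArg (germ (t.ind.T.obj X) i) (h.c_p _))

theorem ind_c_add (X : IndObj C) (h' : HasTangentPullbacks t.ind)
    (e : (t.ind.T.map (t.ind.π₁.app X) ≫ t.ind.c.app X) ≫ t.ind.p.app (t.ind.T.obj X) =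
      (t.ind.T.map (t.ind.π₂.app X) ≫ t.ind.c.app X) ≫ t.ind.p.app (t.ind.T.obj X)) :
    t.ind.T.map (t.ind.add.app X) ≫ t.ind.c.app X =
      h'.pair (X := t.ind.T.obj X) (t.ind.T.map (t.ind.π₁.app X) ≫ t.ind.c.app X)
        (t.ind.T.map (t.ind.π₂.app X) ≫ t.ind.c.app X) e ≫ t.ind.add.app (t.ind.T.obj X) :=
  IndObj.Hom.ext (funext fun i => by
    refine Eq.trans ?_ (h.ind_pair_add_val h' e (j := i)
      (φ := t.T.map (t.π₁.app (X.F.obj i)) ≫ t.c.app (X.F.obj i))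
      (ψ := t.T.map (t.π₂.app (X.F.obj i)) ≫ t.c.app (X.F.obj i)) ?_ ?_
      (h.c_add_condition _)).symm
    · rw [ind_c_app]
      exact congrArg (germ (t.ind.T.obj (t.ind.T.obj X)) i) (h.c_add _)
    · rw [ind_c_app]
      rfl
    · rw [ind_c_app]
      rfl)

theorem ind_c_zero (X : IndObj C) :
    t.ind.T.map (t.ind.zero.app X) ≫ t.ind.c.app X = t.ind.zero.app (t.ind.T.obj X) := by
  rw [ind_c_app, ind_zero_app, ind_zero_app]
  exact IndObj.Hom.ext (funext fun i =>
    congrArg (germ (t.ind.T.obj (t.ind.T.obj X)) i) (h.c_zero _))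

theorem ind_c_c (X : IndObj C) :
    t.ind.c.app X ≫ t.ind.c.app X = 𝟙 (t.ind.T.obj (t.ind.T.obj X)) := by
  rw [ind_c_app]
  exact IndObj.Hom.ext (funext fun i =>
    congrArg (germ (t.ind.T.obj (t.ind.T.obj X)) i) (h.c_c _))

theorem ind_ℓ_c (X : IndObj C) : t.ind.ℓ.app X ≫ t.ind.c.app X = t.ind.ℓ.app X := by
  rw [ind_c_app, ind_ℓ_app]
  exact IndObj.Hom.ext (funext fun i =>
    congrArg (germ (t.ind.T.obj (t.ind.T.obj X)) i) (h.ℓ_c _))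

theorem ind_ℓ_p (X : IndObj C) :
    t.ind.ℓ.app X ≫ t.ind.T.map (t.ind.p.app X) = t.ind.p.app X ≫ t.ind.zero.app X := by
  rw [ind_ℓ_app, ind_p_app, ind_zero_app]
  exact IndObj.Hom.ext (funext fun i => congrArg (germ (t.ind.T.obj X) i) (h.ℓ_p _))

theorem ind_ℓ_add (X : IndObj C) (h' : HasTangentPullbacks t.ind)
    (e : (t.ind.π₁.app X ≫ t.ind.ℓ.app X) ≫ t.ind.p.app (t.ind.T.obj X) =
      (t.ind.π₂.app X ≫ t.ind.ℓ.app X) ≫ t.ind.p.app (t.ind.T.obj X)) :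
    t.ind.add.app X ≫ t.ind.ℓ.app X =
      h'.pair (X := t.ind.T.obj X) (t.ind.π₁.app X ≫ t.ind.ℓ.app X)
        (t.ind.π₂.app X ≫ t.ind.ℓ.app X) e ≫ t.ind.add.app (t.ind.T.obj X) :=
  IndObj.Hom.ext (funext fun i => by
    refine Eq.trans ?_ (h.ind_pair_add_val h' e (j := i)
      (φ := t.π₁.app (X.F.obj i) ≫ t.ℓ.app (X.F.obj i))
      (ψ := t.π₂.app (X.F.obj i) ≫ t.ℓ.app (X.F.obj i)) ?_ ?_
      (h.ℓ_add_condition _)).symm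
    · rw [ind_ℓ_app]
      exact congrArg (germ (t.ind.T.obj (t.ind.T.obj X)) i) (h.ℓ_add _)
    · rw [ind_ℓ_app]
      rfl
    · rw [ind_ℓ_app]
      rfl)

theorem ind_ℓ_zero (X : IndObj C) :
    t.ind.zero.app X ≫ t.ind.ℓ.app X = t.ind.zero.app X ≫ t.ind.zero.app (t.ind.T.obj X) := by
  rw [ind_ℓ_app, ind_zero_app, ind_zero_app]
  exact IndObj.Hom.ext (funext fun i =>
    congrArg (germ (t.ind.T.obj (t.ind.T.obj X)) i) (h.ℓ_zero _))

theorem ind_ℓ_ℓ (X : IndObj C) :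
    t.ind.ℓ.app X ≫ t.ind.T.map (t.ind.ℓ.app X) =
      t.ind.ℓ.app X ≫ t.ind.ℓ.app (t.ind.T.obj X) := by
  rw [ind_ℓ_app, ind_ℓ_app]
  exact IndObj.Hom.ext (funext fun i =>
    congrArg (germ (t.ind.T.obj (t.ind.T.obj (t.ind.T.obj X))) i) (h.ℓ_ℓ _))

theorem ind_c_braid (X : IndObj C) :
    t.ind.T.map (t.ind.c.app X) ≫ t.ind.c.app (t.ind.T.obj X) ≫ t.ind.T.map (t.ind.c.app X) =
      t.ind.c.app (t.ind.T.obj X) ≫ t.ind.T.map (t.ind.c.app X) ≫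
        t.ind.c.app (t.ind.T.obj X) := by
  rw [ind_c_app, ind_c_app]
  exact IndObj.Hom.ext (funext fun i =>
    congrArg (germ (t.ind.T.obj (t.ind.T.obj (t.ind.T.obj X))) i)
      (h.c_braid _))

theorem ind_c_ℓ (X : IndObj C) :
    t.ind.ℓ.app (t.ind.T.obj X) ≫ t.ind.T.map (t.ind.c.app X) ≫ t.ind.c.app (t.ind.T.obj X) =
      t.ind.c.app X ≫ t.ind.T.map (t.ind.ℓ.app X) := by
  rw [ind_c_app, ind_c_app, ind_ℓ_app, ind_ℓ_app]
  exact IndObj.Hom.ext (funext fun i =>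
    congrArg (germ (t.ind.T.obj (t.ind.T.obj (t.ind.T.obj X))) i)
      (h.c_ℓ _))

/-- Both morphisms have the same two projections from the pullback `Ind(T)(Ind(T₂)(X))`. The
levelwise form is needed to apply `isLimit_fork_ofSystem`. -/
theorem ind_mapPair (X : IndObj C) (h' : HasTangentPullbacks t.ind)
    (e : (t.ind.π₁.app X ≫ t.ind.ℓ.app X) ≫ t.ind.T.map (t.ind.p.app X) =
      (t.ind.π₂.app X ≫ t.ind.zero.app (t.ind.T.obj X)) ≫ t.ind.T.map (t.ind.p.app X)) :
    h'.mapPair (X := X) (t.ind.π₁.app X ≫ t.ind.ℓ.app X)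
        (t.ind.π₂.app X ≫ t.ind.zero.app (t.ind.T.obj X)) e =
      (ofSystem X.I C).map (Functor.whiskerLeft X.F h.liftPair) := by
  refine (h'.map_isPullback X).hom_ext ?_ ?_
  · refine (IsPullback.lift_fst _ _ _ _).trans ?_
    rw [ind_ℓ_app]
    exact IndObj.Hom.ext (funext fun i => congrArg (germ (t.ind.T.obj (t.ind.T.obj X)) i)
      (IsPullback.lift_fst (h.map_isPullback (X.F.obj i)) _ _ (h.verticalLift_condition _)).symm)
  · refine (IsPullback.lift_snd _ _ _ _).trans ?_
    rw [ind_zero_app]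
    exact IndObj.Hom.ext (funext fun i => congrArg (germ (t.ind.T.obj (t.ind.T.obj X)) i)
      (IsPullback.lift_snd (h.map_isPullback (X.F.obj i)) _ _ (h.verticalLift_condition _)).symm)

theorem verticalLift_w :
    h.verticalLift ≫ Functor.whiskerRight t.p t.T =
      h.verticalLift ≫ Functor.whiskerLeft t.T t.p ≫ t.p ≫ t.zero :=
  NatTrans.ext (funext fun X => (h.isEqualizer X).1)

omit h in
theorem ind_map_p_app (X : IndObj C) :
    t.ind.T.map (t.ind.p.app X) =
      (ofSystem X.I C).map (Functor.whiskerLeft X.F (Functor.whiskerRight t.p t.T)) := by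
  rw [ind_p_app]
  rfl

omit h in
theorem ind_p_p_zero_app (X : IndObj C) :
    t.ind.p.app (t.ind.T.obj X) ≫ t.ind.p.app X ≫ t.ind.zero.app X =
      (ofSystem X.I C).map
        (Functor.whiskerLeft X.F (Functor.whiskerLeft t.T t.p ≫ t.p ≫ t.zero)) := by
  rw [ind_p_app, ind_p_app, ind_zero_app]
  rfl

theorem ind_isEqualizer (X : IndObj C) (h' : HasTangentPullbacks t.ind)
    (e : (t.ind.π₁.app X ≫ t.ind.ℓ.app X) ≫ t.ind.T.map (t.ind.p.app X) =
      (t.ind.π₂.app X ≫ t.ind.zero.app (t.ind.T.obj X)) ≫ t.ind.T.map (t.ind.p.app X)) :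
    ∃ w : (h'.mapPair (X := X) (t.ind.π₁.app X ≫ t.ind.ℓ.app X)
          (t.ind.π₂.app X ≫ t.ind.zero.app (t.ind.T.obj X)) e ≫ t.ind.T.map (t.ind.add.app X)) ≫
            t.ind.T.map (t.ind.p.app X) =
        (h'.mapPair (X := X) (t.ind.π₁.app X ≫ t.ind.ℓ.app X)
          (t.ind.π₂.app X ≫ t.ind.zero.app (t.ind.T.obj X)) e ≫ t.ind.T.map (t.ind.add.app X)) ≫
            t.ind.p.app (t.ind.T.obj X) ≫ t.ind.p.app X ≫ t.ind.zero.app X,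
      Nonempty (IsLimit (Fork.ofι _ w)) := by
  -- The fork and its two parallel arrows are now images under `ofSystem`, and at each level they
  -- form the equalizer given by the axiom in `C`.
  rw [ind_mapPair h X h' e, ind_map_p_app X, ind_p_p_zero_app X]
  have w : Functor.whiskerLeft X.F h.verticalLift ≫
        Functor.whiskerLeft X.F (Functor.whiskerRight t.p t.T) =
      Functor.whiskerLeft X.F h.verticalLift ≫
        Functor.whiskerLeft X.F (Functor.whiskerLeft t.T t.p ≫ t.p ≫ t.zero) :=
    congrArg (Functor.whiskerLeft X.F) (verticalLift_w h)
  have key := isLimit_fork_ofSystem X.I w (fun i => (h.isEqualizer (X.F.obj i)).2)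
  exact ⟨_, key⟩

/-- The ind-tangent structure satisfies the axioms of a tangent structure. -/
theorem ind_isTangent : IsTangent t.ind where
  toHasTangentPullbacks := t.ind_hasTangentPullbacks h.toHasTangentPullbacks
  zero_p := ind_zero_p h
  add_p := ind_add_p h
  zero_add X := ind_zero_add h X _ _
  add_comm X := ind_add_comm h X _ _
  add_assoc x y z hxy hyz := ind_add_assoc h _ x y z hxy hyz _ _
  c_p := ind_c_p h
  c_add X := ind_c_add h X _ _
  c_zero := ind_c_zero h
  c_c := ind_c_c h
  ℓ_c := ind_ℓ_c h
  ℓ_p := ind_ℓ_p h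
  ℓ_add X := ind_ℓ_add h X _ _
  ℓ_zero := ind_ℓ_zero h
  ℓ_ℓ := ind_ℓ_ℓ h
  c_braid := ind_c_braid h
  c_ℓ := ind_c_ℓ h
  isEqualizer X := ind_isEqualizer h X _ _

end TangentData

end IndTangent

end IndTan

/-! ### Tangent morphisms, strength and tangent transformations -/

namespace IndTan

open IndObj

section IndMorphism

variable {C : Type u₁} [Category.{v} C] {D : Type u₂} [Category.{v} D]

theorem indHat_app {T : C ⥤ C} {S : D ⥤ D} {F : C ⥤ D} (α : T ⋙ F ⟶ F ⋙ S) (X : IndObj C) :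
    (indHat α).app X = (ofSystem X.I D).map (Functor.whiskerLeft X.F α) :=
  IndObj.Hom.ext (funext fun i => congrArg (germ ((indFunctor (F ⋙ S)).obj X) i)
    ((Category.id_comp _).trans (Category.comp_id (α.app (X.F.obj i)))))

/-- This composite occurs in the compatibilities with `ℓ` and `c`; as a single levelwise map it
reduces them to those of `α`. -/
theorem indHat_comp_map_indHat {T : C ⥤ C} {S : D ⥤ D} {F : C ⥤ D} (α : T ⋙ F ⟶ F ⋙ S)
    (X : IndObj C) :
    (indHat α).app ((indFunctor T).obj X) ≫ (indFunctor S).map ((indHat α).app X) =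
      (ofSystem X.I D).map (Functor.whiskerLeft X.F
        (Functor.whiskerLeft T α ≫ Functor.whiskerRight α S)) := by
  rw [indHat_app, indHat_app]
  rfl

variable {t : TangentStructure C} {s : TangentStructure D} {F : C ⥤ D}
  {α : t.T ⋙ F ⟶ F ⋙ s.T}

namespace IsTangentMorphism

variable (h : IsTangentMorphism t s F α)

include h

theorem add_condition (A : C) :
    (F.map (t.π₁.app A) ≫ α.app A) ≫ s.p.app (F.obj A) =
      (F.map (t.π₂.app A) ≫ α.app A) ≫ s.p.app (F.obj A) := by
  rw [Category.assoc, Category.assoc, h.p, ← F.map_comp, ← F.map_comp,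
    (t.isTangent.isPullback A).w]

theorem ind_p (X : IndObj C) :
    (indHat α).app X ≫ s.toTangentData.ind.p.app ((indFunctor F).obj X) =
      (indFunctor F).map (t.toTangentData.ind.p.app X) := by
  rw [indHat_app, TangentData.ind_p_app, TangentData.ind_p_app]
  exact IndObj.Hom.ext (funext fun i => congrArg (germ ((indFunctor F).obj X) i) (h.p _))

theorem ind_zero (X : IndObj C) :
    (indFunctor F).map (t.toTangentData.ind.zero.app X) ≫ (indHat α).app X =
      s.toTangentData.ind.zero.app ((indFunctor F).obj X) := by
  rw [indHat_app, TangentData.ind_zero_app, TangentData.ind_zero_app]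
  exact IndObj.Hom.ext (funext fun i =>
    congrArg (germ ((indFunctor (F ⋙ s.T)).obj X) i) (h.zero _))

theorem ind_add (X : IndObj C) (h' : HasTangentPullbacks s.toTangentData.ind)
    (e : ((indFunctor F).map (t.toTangentData.ind.π₁.app X) ≫ (indHat α).app X) ≫
        s.toTangentData.ind.p.app ((indFunctor F).obj X) =
      ((indFunctor F).map (t.toTangentData.ind.π₂.app X) ≫ (indHat α).app X) ≫
        s.toTangentData.ind.p.app ((indFunctor F).obj X)) :
    (indFunctor F).map (t.toTangentData.ind.add.app X) ≫ (indHat α).app X =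
      h'.pair (X := (indFunctor F).obj X)
        ((indFunctor F).map (t.toTangentData.ind.π₁.app X) ≫ (indHat α).app X)
        ((indFunctor F).map (t.toTangentData.ind.π₂.app X) ≫ (indHat α).app X) e ≫
          s.toTangentData.ind.add.app ((indFunctor F).obj X) :=
  IndObj.Hom.ext (funext fun i => by
    refine Eq.trans ?_ (s.isTangent.ind_pair_add_val h' e (j := i)
      (φ := F.map (t.π₁.app (X.F.obj i)) ≫ α.app (X.F.obj i))
      (ψ := F.map (t.π₂.app (X.F.obj i)) ≫ α.app (X.F.obj i)) ?_ ?_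
      (h.add_condition _)).symm
    · rw [indHat_app]
      exact congrArg (germ ((indFunctor (F ⋙ s.T)).obj X) i) (h.add _)
    · rw [indHat_app]
      rfl
    · rw [indHat_app]
      rfl)

theorem ind_ℓ (X : IndObj C) :
    (indHat α).app X ≫ s.toTangentData.ind.ℓ.app ((indFunctor F).obj X) =
      (indFunctor F).map (t.toTangentData.ind.ℓ.app X) ≫
        (indHat α).app ((indFunctor t.T).obj X) ≫ (indFunctor s.T).map ((indHat α).app X) := by
  refine Eq.trans ?_ (congrArg ((indFunctor F).map (t.toTangentData.ind.ℓ.app X) ≫ ·)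
    (indHat_comp_map_indHat α X).symm)
  rw [indHat_app, TangentData.ind_ℓ_app, TangentData.ind_ℓ_app]
  exact IndObj.Hom.ext (funext fun i =>
    congrArg (germ ((indFunctor (F ⋙ s.T ⋙ s.T)).obj X) i) (h.ℓ _))

theorem ind_c (X : IndObj C) :
    ((indHat α).app ((indFunctor t.T).obj X) ≫ (indFunctor s.T).map ((indHat α).app X)) ≫
        s.toTangentData.ind.c.app ((indFunctor F).obj X) =
      (indFunctor F).map (t.toTangentData.ind.c.app X) ≫
        (indHat α).app ((indFunctor t.T).obj X) ≫ (indFunctor s.T).map ((indHat α).app X) := by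
  refine (congrArg (· ≫ s.toTangentData.ind.c.app ((indFunctor F).obj X))
    (indHat_comp_map_indHat α X)).trans (Eq.trans ?_
      (congrArg ((indFunctor F).map (t.toTangentData.ind.c.app X) ≫ ·)
        (indHat_comp_map_indHat α X).symm))
  rw [TangentData.ind_c_app, TangentData.ind_c_app]
  exact IndObj.Hom.ext (funext fun i =>
    congrArg (germ ((indFunctor (F ⋙ s.T ⋙ s.T)).obj X) i) (h.c _))

/-- `(Ind(F), α̂)` is a tangent morphism. -/
theorem ind (ht : IsTangent t.toTangentData.ind) (hs : IsTangent s.toTangentData.ind) :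
    IsTangentMorphism (t.ind ht) (s.ind hs) (indFunctor F) (indHat α) where
  p := h.ind_p
  zero := h.ind_zero
  add X := h.ind_add X _ _
  ℓ := h.ind_ℓ
  c := h.ind_c

end IsTangentMorphism

/-- The pair of morphisms in the universality of the vertical lift. -/
abbrev TangentData.liftDiagram (t : TangentData C) (A : C) : WalkingParallelPair ⥤ C :=
  parallelPair (t.T.map (t.p.app A)) (t.p.app (t.T.obj A) ≫ t.p.app A ≫ t.zero.app A)

theorem TangentStructure.hasLimit_liftDiagram (t : TangentStructure C) (A : C) :
    HasLimit (t.liftDiagram A) :=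
  ⟨⟨_, (t.isTangent.isEqualizer A).2.some⟩⟩

/-- The levelwise pairs of morphisms in the universality of the vertical lift. -/
abbrev TangentData.liftSystem (t : TangentData C) (X : IndObj C) :
    WalkingParallelPair ⥤ X.I ⥤ C :=
  parallelPair (Functor.whiskerLeft X.F (Functor.whiskerRight t.p t.T))
    (Functor.whiskerLeft X.F (Functor.whiskerLeft t.T t.p ≫ t.p ≫ t.zero))

/-- The vertical lift diagram of an ind-object is given by the levelwise ones. -/
def TangentData.liftSystemIso (t : TangentData C) (X : IndObj C) :
    t.liftSystem X ⋙ ofSystem X.I C ≅ t.ind.liftDiagram X :=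
  diagramIsoParallelPair _ ≪≫ eqToIso (congrArg₂ (fun f g => parallelPair
    (X := t.ind.T.obj (t.ind.T.obj X)) (Y := t.ind.T.obj X) f g)
    (TangentData.ind_map_p_app X).symm (TangentData.ind_p_p_zero_app X).symm)

/-- The levelwise vertical lift diagrams at one level. -/
def TangentData.liftSystemEvaluationIso (t : TangentData C) (X : IndObj C) (i : X.I) :
    t.liftSystem X ⋙ (evaluation X.I C).obj i ≅ t.liftDiagram (X.F.obj i) :=
  diagramIsoParallelPair _

/-- The universality of the vertical lift provides the levelwise equalizers that
`preservesLimit_indFunctor` requires. -/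
theorem preservesLimit_ind_liftDiagram (t : TangentStructure C) (F : C ⥤ D)
    (hF : ∀ A, PreservesLimit (t.liftDiagram A) F) (X : IndObj C) :
    PreservesLimit (t.toTangentData.ind.liftDiagram X) (indFunctor F) := by
  have : ∀ i, HasLimit (t.liftSystem X ⋙ (evaluation X.I C).obj i) := fun i =>
    have := t.hasLimit_liftDiagram (X.F.obj i)
    hasLimit_of_iso (t.liftSystemEvaluationIso X i).symm
  have : ∀ i, PreservesLimit (t.liftSystem X ⋙ (evaluation X.I C).obj i) F := fun i =>
    preservesLimit_of_iso_diagram F (t.liftSystemEvaluationIso X i).symm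
  have := preservesLimit_indFunctor X.I (t.liftSystem X) F
  exact preservesLimit_of_iso_diagram (indFunctor F) (t.liftSystemIso X)

theorem isIso_indHat {T : C ⥤ C} {S : D ⥤ D} {F : C ⥤ D} (α : T ⋙ F ⟶ F ⋙ S) [IsIso α] :
    IsIso (indHat α) := by
  have : ∀ X, IsIso ((indHat α).app X) := fun X => by
    rw [indHat_app]
    exact Functor.map_isIso (ofSystem X.I D) (Functor.whiskerLeft X.F α)
  exact NatIso.isIso_of_isIso_app _

/-- `Ind(F)` extends `F`. -/
def constCompIndFunctor (F : C ⥤ D) : const C ⋙ indFunctor F ≅ F ⋙ const D :=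
  NatIso.ofComponents (fun A => (ofSystem _ D).mapIso (Functor.constComp _ A F))
    (fun {_ B} f => IndObj.Hom.ext (funext fun i =>
      congrArg (germ ((const D).obj (F.obj B)) i)
        ((Category.comp_id (F.map f)).trans (Category.id_comp (F.map f)).symm)))

/-- Up to the canonical identifications, `α̂` at a constant ind-object is the constant morphism on
`α_A`. As `const` reflects isomorphisms, `α_A` is invertible if `α̂` is. -/
theorem indHat_app_const {T : C ⥤ C} {S : D ⥤ D} {F : C ⥤ D} (α : T ⋙ F ⟶ F ⋙ S) (A : C) :
    (const D).map (α.app A) = (constCompIndFunctor (T ⋙ F)).inv.app A ≫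
      (ofSystem _ D).map (Functor.whiskerLeft ((const C).obj A).F α) ≫
        (constCompIndFunctor (F ⋙ S)).hom.app A :=
  IndObj.Hom.ext (funext fun i => congrArg (germ ((const D).obj (S.obj (F.obj A))) i)
    ((Category.id_comp _).trans (Category.comp_id (α.app A))).symm)

theorem isIso_of_isIso_indHat {T : C ⥤ C} {S : D ⥤ D} {F : C ⥤ D} (α : T ⋙ F ⟶ F ⋙ S)
    [IsIso (indHat α)] : IsIso α := by
  have : ∀ A, IsIso (α.app A) := fun A => by
    have h : IsIso ((indHat α).app ((const C).obj A)) := inferInstance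
    rw [indHat_app] at h
    have : IsIso ((const D).map (α.app A)) := by
      rw [indHat_app_const]
      exact IsIso.comp_isIso' inferInstance (IsIso.comp_isIso' h
        ((constCompIndFunctor (F ⋙ S)).app A).isIso_hom)
    exact isIso_of_reflects_iso (α.app A) (const D)
  exact NatIso.isIso_of_isIso_app _

/-- `F` preserves a finite limit if `Ind(F)` preserves it. -/
theorem preservesLimit_of_indFunctor {J : Type} [SmallCategory J] [FinCategory J] (K : J ⥤ C)
    [HasLimit K] (F : C ⥤ D) [PreservesLimit (K ⋙ const C) (indFunctor F)] :
    PreservesLimit K F := by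
  have := preservesLimit_const K
  have : PreservesLimit K (F ⋙ const D) :=
    preservesLimit_of_natIso K (constCompIndFunctor F)
  exact preservesLimit_of_reflects_of_preserves F (const D)

/-- This is the naturality square at the legs of the cospan in `powerDiagramConstIso`. -/
theorem TangentData.const_p_app (t : TangentData C) (A : C) :
    (constCompIndFunctor t.T).hom.app A ≫ (const C).map (t.p.app A) =
      t.ind.p.app ((const C).obj A) := by
  rw [ind_p_app]
  exact IndObj.Hom.ext (funext fun i => congrArg (germ ((const C).obj A) i)
    (Category.id_comp (t.p.app A)))

/-- The pullback diagram of a constant ind-object. -/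
def TangentData.powerDiagramConstIso (t : TangentData C) (n : ℕ) (A : C) :
    t.ind.powerDiagram n ((const C).obj A) ≅ t.powerDiagram n A ⋙ const C :=
  NatIso.ofComponents
    (fun j => match j with
      | none => Iso.refl _
      | some _ => (constCompIndFunctor t.T).app A)
    (fun {j k} f => match j, k, f with
      | _, _, WidePullbackShape.Hom.id j =>
        ((congrArg (· ≫ _) ((t.ind.powerDiagram n ((const C).obj A)).map_id j)).trans
          (Category.id_comp _)).trans ((congrArg (_ ≫ ·)
            ((t.powerDiagram n A ⋙ const C).map_id j)).trans (Category.comp_id _)).symm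
      | _, _, WidePullbackShape.Hom.term _ =>
        (Category.comp_id _).trans (t.const_p_app A).symm)

/-- The diagram of the vertical lift of a constant ind-object. -/
def TangentData.liftDiagramConstIso (t : TangentData C) (A : C) :
    t.ind.liftDiagram ((const C).obj A) ≅ t.liftDiagram A ⋙ const C :=
  parallelPair.ext ((constCompIndFunctor (t.T ⋙ t.T)).app A) ((constCompIndFunctor t.T).app A)
    (by
      refine (congrArg (· ≫ (constCompIndFunctor t.T).hom.app A)
        (TangentData.ind_map_p_app ((const C).obj A))).trans ?_
      exact IndObj.Hom.ext (funext fun i => congrArg (germ ((const C).obj (t.T.obj A)) i)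
        ((Category.comp_id _).trans (Category.id_comp (t.T.map (t.p.app A))).symm)))
    (by
      refine (congrArg (· ≫ (constCompIndFunctor t.T).hom.app A)
        (TangentData.ind_p_p_zero_app ((const C).obj A))).trans ?_
      exact IndObj.Hom.ext (funext fun i => congrArg (germ ((const C).obj (t.T.obj A)) i)
        ((Category.comp_id _).trans (Category.id_comp
          (t.p.app (t.T.obj A) ≫ t.p.app A ≫ t.zero.app A)).symm)))

/-- `(Ind(F), α̂)` is strong if and only if `(F, α)` is. -/
theorem IsTangentMorphism.ind_strong_iff (h : IsTangentMorphism t s F α)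
    (ht : IsTangent t.toTangentData.ind) (hs : IsTangent s.toTangentData.ind) :
    IsStrongTangentMorphism (t.ind ht) (s.ind hs) (indFunctor F) (indHat α) ↔
      IsStrongTangentMorphism t s F α := by
  constructor
  · intro H
    refine ⟨h, ?_, fun n A => ?_, fun A => ?_⟩
    · have : IsIso (indHat α) := H.isIso
      exact isIso_of_isIso_indHat α
    -- Strength of `Ind(F)` is used only at the constant ind-object on `A`, whose pullback diagram
    -- is the image of that of `A` under `const`. The equalizers below are treated in the same way.
    · have := t.isTangent.hasLimit_power n A
      have : PreservesLimit (t.toTangentData.ind.powerDiagram n ((const C).obj A))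
        (indFunctor F) := H.preserves_power n ((const C).obj A)
      have := preservesLimit_of_iso_diagram (indFunctor F) (t.powerDiagramConstIso n A)
      exact preservesLimit_of_indFunctor _ F
    · have := t.hasLimit_liftDiagram A
      have : PreservesLimit (t.toTangentData.ind.liftDiagram ((const C).obj A))
        (indFunctor F) := H.preserves_equalizer ((const C).obj A)
      have := preservesLimit_of_iso_diagram (indFunctor F) (t.liftDiagramConstIso A)
      exact preservesLimit_of_indFunctor (t.liftDiagram A) F
  · intro H
    have := H.isIso
    exact ⟨h.ind ht hs, isIso_indHat α,
      fun n => t.preservesLimit_ind_powerDiagram t.isTangent.toHasTangentPullbacks F n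
        (H.preserves_power n),
      preservesLimit_ind_liftDiagram t F H.preserves_equalizer⟩

theorem IsTangentTransformation.ind {G : C ⥤ D} {β : t.T ⋙ G ⟶ G ⋙ s.T} {ρ : F ⟶ G}
    (h : IsTangentTransformation t s α β ρ)
    (ht : IsTangent t.toTangentData.ind) (hs : IsTangent s.toTangentData.ind) :
    IsTangentTransformation (t.ind ht) (s.ind hs) (indHat α) (indHat β) (indNatTrans ρ) := by
  intro X
  rw [indHat_app, indHat_app]
  exact IndObj.Hom.ext (funext fun i =>
    congrArg (germ ((indFunctor (G ⋙ s.T)).obj X) i) (h (X.F.obj i)))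

end IndMorphism

end IndTan

/-! ### The pseudofunctor on tangent categories and its forgetful image -/

namespace IndTan

section Pseudofunctor

/-- An object universe of the form `max u (v + 1)` has room for the indexing categories, so `Ind`
does not leave it. -/
theorem TanCat.ind_isTangent (X : TanCat.{v, max u (v + 1)}) : IsTangent X.str.toTangentData.ind :=
  TangentData.ind_isTangent X.str.isTangent

theorem TanCat.Hom.ind {X Y : TanCat.{v, max u (v + 1)}} (f : X ⟶ Y) :
    IsTangentMorphism (X.str.ind X.ind_isTangent) (Y.str.ind Y.ind_isTangent)
      (indFunctor (TanCat.Hom.F f)) (indHat (TanCat.Hom.α f)) :=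
  (TanCat.Hom.isTangentMorphism f).ind _ _

theorem TanCat.Hom₂.ind {X Y : TanCat.{v, max u (v + 1)}} {f g : X ⟶ Y} (r : f ⟶ g) :
    IsTangentTransformation (X.str.ind X.ind_isTangent) (Y.str.ind Y.ind_isTangent)
      (indHat (TanCat.Hom.α f)) (indHat (TanCat.Hom.α g)) (indNatTrans (TanCat.Hom₂.ρ r)) :=
  (TanCat.Hom₂.isTangentTransformation r).ind _ _

/-- The action of `Ind` on tangent categories, tangent morphisms and tangent transformations. -/
abbrev indTanStruct : PrelaxFunctorStruct TanCat.{v, max u (v + 1)} TanCat.{v, max u (v + 1)} :=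
  indTan.{v, u} TanCat.ind_isTangent TanCat.Hom.ind TanCat.Hom₂.ind

/-- The unit constraint of `Ind`. -/
def indTanMapId (X : TanCat.{v, max u (v + 1)}) :
    indTanStruct.{v, u}.map (𝟙 X) ≅ 𝟙 (indTanStruct.{v, u}.obj X) :=
  TanCat.isoMk (indId X.carrier)
    (fun (A : IndObj.{v, max u (v + 1)} X.carrier) => IndObj.Hom.ext (funext fun i =>
      congrArg (IndObj.germ ((indFunctor X.str.T).obj A) i) (by
        change (𝟙 _ ≫ 𝟙 _ ≫ 𝟙 _) ≫ X.str.T.map (𝟙 (A.F.obj i)) = 𝟙 _ ≫ 𝟙 _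
        simp)))
    (fun (A : IndObj.{v, max u (v + 1)} X.carrier) => IndObj.Hom.ext (funext fun i =>
      congrArg (IndObj.germ ((indFunctor X.str.T).obj A) i) (by
        change 𝟙 _ ≫ X.str.T.map (𝟙 (A.F.obj i)) = 𝟙 _ ≫ 𝟙 _ ≫ 𝟙 _ ≫ 𝟙 _
        simp)))

/-- The compositor of `Ind`. -/
def indTanMapComp {X Y Z : TanCat.{v, max u (v + 1)}} (f : X ⟶ Y) (g : Y ⟶ Z) :
    indTanStruct.{v, u}.map (f ≫ g) ≅ indTanStruct.{v, u}.map f ≫ indTanStruct.{v, u}.map g :=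
  TanCat.isoMk (indComp (TanCat.Hom.F f) (TanCat.Hom.F g)).symm
    (fun (A : IndObj.{v, max u (v + 1)} X.carrier) => IndObj.Hom.ext (funext fun i =>
      congrArg (IndObj.germ ((indFunctor Z.str.T).obj ((indFunctor g.F).obj
          ((indFunctor f.F).obj A))) i) (by
        -- On representatives both sides are the composite of the components of `f.α` and `g.α`; the
        -- identities come from `φ`.
        change (𝟙 _ ≫ (g.F.map (f.α.app (A.F.obj i)) ≫ g.α.app (f.F.obj (A.F.obj i))) ≫ 𝟙 _) ≫
            Z.str.T.map (𝟙 (g.F.obj (f.F.obj (A.F.obj i)))) =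
          𝟙 _ ≫ g.F.map (𝟙 _ ≫ f.α.app (A.F.obj i) ≫ 𝟙 _) ≫
            𝟙 _ ≫ g.α.app (f.F.obj (A.F.obj i)) ≫ 𝟙 _
        simp)))
    (fun (A : IndObj.{v, max u (v + 1)} X.carrier) => IndObj.Hom.ext (funext fun i =>
      congrArg (IndObj.germ ((indFunctor Z.str.T).obj ((indFunctor g.F).obj
          ((indFunctor f.F).obj A))) i) (by
        change (g.F.map (𝟙 _ ≫ f.α.app (A.F.obj i) ≫ 𝟙 _) ≫
            𝟙 _ ≫ g.α.app (f.F.obj (A.F.obj i)) ≫ 𝟙 _) ≫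
            Z.str.T.map (𝟙 (g.F.obj (f.F.obj (A.F.obj i)))) =
          𝟙 _ ≫ 𝟙 _ ≫ (g.F.map (f.α.app (A.F.obj i)) ≫ g.α.app (f.F.obj (A.F.obj i))) ≫ 𝟙 _
        simp)))

/-- The forgetful functor is faithful on 2-cells, so the coherence laws may be checked in `Cat`,
where they are those of `indCat`. -/
theorem TanCat.hom₂_ext_forget {X Y : TanCat.{v, u}} {f g : X ⟶ Y} {r s : f ⟶ g}
    (h : TanCat.forget.map₂ r = TanCat.forget.map₂ s) : r = s :=
  TanCat.Hom₂.ext (congrArg Cat.Hom₂.toNatTrans h)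

/-- The pseudofunctor `Ind` on tangent categories. -/
def indTanPseudofunctor : Pseudofunctor TanCat.{v, max u (v + 1)} TanCat.{v, max u (v + 1)} where
  toPrelaxFunctorStruct := indTanStruct.{v, u}
  mapId := indTanMapId.{v, u}
  mapComp := indTanMapComp.{v, u}
  map₂_id f := TanCat.Hom₂.ext (indNatTrans_id (TanCat.Hom.F f))
  map₂_comp r s := TanCat.Hom₂.ext (indNatTrans_comp (TanCat.Hom₂.ρ r) (TanCat.Hom₂.ρ s))
  map₂_whisker_left f _ _ r := TanCat.hom₂_ext_forget
    (indCat.{v, u}.map₂_whisker_left (TanCat.Hom.F f).toCatHom (TanCat.Hom₂.ρ r).toCatHom₂)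
  map₂_whisker_right r h := TanCat.hom₂_ext_forget
    (indCat.{v, u}.map₂_whisker_right (TanCat.Hom₂.ρ r).toCatHom₂ (TanCat.Hom.F h).toCatHom)
  map₂_associator f g h := TanCat.hom₂_ext_forget
    (indCat.{v, u}.map₂_associator (TanCat.Hom.F f).toCatHom (TanCat.Hom.F g).toCatHom
      (TanCat.Hom.F h).toCatHom)
  map₂_left_unitor f := TanCat.hom₂_ext_forget
    (indCat.{v, u}.map₂_left_unitor (TanCat.Hom.F f).toCatHom)
  map₂_right_unitor f := TanCat.hom₂_ext_forget
    (indCat.{v, u}.map₂_right_unitor (TanCat.Hom.F f).toCatHom)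

/-- The types of the constraints depend on the underlying prelax functor, hence the heterogeneous
equalities. -/
theorem pseudofunctor_ext {B : Type u₁} [Bicategory.{v, v} B] {B' : Type u₂}
    [Bicategory.{u, u₃} B'] {P Q : Pseudofunctor B B'}
    (h : P.toPrelaxFunctor = Q.toPrelaxFunctor) (hid : HEq P.mapId Q.mapId)
    (hcomp : HEq (@P.mapComp) (@Q.mapComp)) : P = Q := by
  cases P
  cases Q
  cases h
  cases hid
  cases hcomp
  rfl

theorem indTanPseudofunctor_comp_forget :
    indTanPseudofunctor.{v, u}.comp TanCat.forget = TanCat.forget.comp indCat.{v, u} := by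
  -- The two prelax functors agree definitionally, so the constraints have the same types. They are
  -- then compared on representatives at each level, where both are composites of identities.
  refine pseudofunctor_ext rfl (heq_of_eq ?_) (heq_of_eq ?_)
  · funext X
    refine Iso.ext (Cat.Hom₂.ext (NatTrans.ext (funext fun
      (A : IndObj.{v, max u (v + 1)} X.carrier) => IndObj.Hom.ext (funext fun i => ?_))))
    rfl
  · funext X Y Z f g
    refine Iso.ext (Cat.Hom₂.ext (NatTrans.ext (funext fun
      (A : IndObj.{v, max u (v + 1)} X.carrier) => IndObj.Hom.ext (funext fun i => ?_))))
    rfl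

end Pseudofunctor

end IndTan

theorem mainTheorem2 :
    (∀ (C : Type u₁) [Category.{v} C] (D : Type u₂) [Category.{v} D]
      (t : TangentStructure C) (s : TangentStructure D) (F : C ⥤ D) (α : t.T ⋙ F ⟶ F ⋙ s.T),
      IsTangentMorphism t s F α →
        ∃ (ht : IsTangent t.toTangentData.ind) (hs : IsTangent s.toTangentData.ind),
          IsTangentMorphism (t.ind ht) (s.ind hs) (indFunctor F) (indHat α) ∧
          (IsStrongTangentMorphism (t.ind ht) (s.ind hs) (indFunctor F) (indHat α) ↔
            IsStrongTangentMorphism t s F α)) ∧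
    (∃ (h₀ : ∀ X : TanCat.{v, max u (v + 1)}, IsTangent X.str.toTangentData.ind)
      (h₁ : ∀ {X Y : TanCat.{v, max u (v + 1)}} (f : X ⟶ Y),
        IsTangentMorphism (X.str.ind (h₀ X)) (Y.str.ind (h₀ Y)) (indFunctor (TanCat.Hom.F f))
          (indHat (TanCat.Hom.α f)))
      (h₂ : ∀ {X Y : TanCat.{v, max u (v + 1)}} {f g : X ⟶ Y} (r : f ⟶ g),
        IsTangentTransformation (X.str.ind (h₀ X)) (Y.str.ind (h₀ Y)) (indHat (TanCat.Hom.α f))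
          (indHat (TanCat.Hom.α g)) (indNatTrans (TanCat.Hom₂.ρ r)))
      (P : Pseudofunctor TanCat.{v, max u (v + 1)} TanCat.{v, max u (v + 1)}),
      P.toPrelaxFunctorStruct = indTan.{v, u} h₀ h₁ h₂ ∧
        P.comp TanCat.forget = TanCat.forget.comp indCat.{v, u}) := by
  exact ⟨fun C _ D _ t s F α h =>
      ⟨TangentData.ind_isTangent t.isTangent, TangentData.ind_isTangent s.isTangent,
        h.ind _ _, h.ind_strong_iff _ _⟩,
    TanCat.ind_isTangent, TanCat.Hom.ind, TanCat.Hom₂.ind, indTanPseudofunctor.{v, u}, rfl,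
    indTanPseudofunctor_comp_forget.{v, u}⟩
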